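/- Let $\hat J=\hat J(x,\gamma)\in C^2(\mathbb R^2\times\mathbb R^2;\mathbb R)$, let $\gamma:[0,\infty)\to\mathbb R^2$, and suppose that for each $t\ge 0$ the function $\hat J(\cdot,\gamma(t))$ has a unique minimizer $x^*(\gamma(t))$. Let $k\in\mathbb N$, $k>1$, $\alpha=4(1-k^{-2})$, $\vartheta>0$. Let $F_1,F_2\in C(\mathbb R;\mathbb R)$ be such that the zeros of $F_1$ are isolated, $F_2(z)=-F_1(z)\int \frac{dz}{F_1(z)^2}$ for some antiderivative of $1/F_1^2$ on $\{F_1\neq0\}$, and $F_s\circ\hat J\in C^1(\mathbb R^2\times\mathbb R^2;\mathbb R)$, $s=1,2$. For $\omega>0$ consider the closed-loop unicycle $$\dot x_1=u^\omega\cos\tfrac{\omega t}{k},\quad \dot x_2=u^\omega\sin\tfrac{\omega t}{k},\qquad u^\omega=\sqrt{\vartheta\alpha\omega}\,\big(F_1(\hat J(x,\gamma(t)))\cos\omega t+F_2(\hat J(x,\gamma(t)))\sin\omega t\big),\tag{1}$$ (that is, $\omega=k\Omega$, where $\Omega$ is the angular velocity), and its Lie bracket system $$\dot{\bar x}=-\vartheta\big(\nabla_{\bar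 x}\hat J(\bar x,\gamma(t))+\Phi(\bar x,\gamma(t))\big),\qquad \Phi=(-\varphi_2,\varphi_1)^T,\quad \varphi_s=\frac1{2k}\frac{\partial}{\partial\bar x_s}\Big(F_1^2(\hat J)+F_2^2(\hat J)\Big).\tag{2}$$ Put $f_i=(F_i(\hat J(x,\gamma(t))),0)^T$ and $f_{i+2}=(0,F_i(\hat J(x,\gamma(t))))^T$ for $i=1,2$, and assume: (A1) $f_1,\dots,f_4$ are $C^2$ functions of $(t,x)\in[0,\infty)\times\mathbb R^2$; (A2) for $1\le j\le m\le 4$, the functions $\|f_j\|$, $\|\partial_t f_j\|$, $\|\partial_x f_j\|$, $\|\partial_t\partial_x f_j\|$, $\|\partial_t[f_j,f_m]\|$, $\|\partial_x[f_j,f_m]\|$, where $[f_j,f_m]=\frac{\partial f_m}{\partial x}f_j-\frac{\partial f_j}{\partial x}f_m$, are bounded on each compact set of $x\in\mathbb R^2$, uniformly in $t\ge0$. Let $\lambda>0$ and $\mathcal L_{\lambda,t}=\{x\in\mathbb R^2:\hat J(x,\gamma(t))-\hat J(x^*(\gamma(t)),\gamma(t))\le\lambda\}$, and suppose that some compact $S\subset\mathbb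 R^2$ contains $\mathcal L_{\lambda,t}$ for all $t\ge0$. If the family $\mathcal L_{\lambda,t}$ is locally (respectively globally) uniformly asymptotically stable for (2), then it is locally (respectively semi-globally) practically uniformly asymptotically stable for (1). Here the stability notions are as follows, for a family of systems with parameter $\omega>0$ and a family of sets $\mathcal L_t$, with $B_\delta(\mathcal L_t)$ the open $\delta$-neighbourhood of $\mathcal L_t$. Every requirement on the solutions includes that the solution with $x(t_0)=x^0$ exists for all $t\ge t_0$. * Practically uniformly stable: for every $\varepsilon>0$ there are $\delta,\omega_0>0$ such that for all $t_0\ge0$, $\omega>\omega_0$: $x^0\in B_\delta(\mathcal L_{t_0})$ implies $x(t)\in B_\varepsilon(\mathcal L_t)$ for all $t\ge t_0$. * $\hat\delta$-practically uniformly attractive: for every $\varepsilon>0$ there are $t_1\ge0$, $\omega_0>0$ such that for all $t_0\ge0$, $\omega>\omega_0$: $x^0\in B_{\hat\delta}(\mathcal L_{t_0})$ implies $x(t)\in B_\varepsilon(\mathcal L_t)$ for all $t\ge t_0+t_1$. * Practically uniformly bounded from $\delta>0$: there are $\varepsilon,\omega_0>0$ such that for all $t_0\ge0$, $\omega>\omega_0$: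 $x^0\in B_\delta(\mathcal L_{t_0})$ implies $x(t)\in B_\varepsilon(\mathcal L_t)$ for all $t\ge t_0$. The family is locally practically uniformly asymptotically stable if it is practically uniformly stable and, for some $\hat\delta>0$, $\hat\delta$-practically uniformly attractive and practically uniformly bounded from every $\delta\in(0,\hat\delta]$. It is semi-globally practically uniformly asymptotically stable if it is practically uniformly stable, $\hat\delta$-practically uniformly attractive for every $\hat\delta>0$, and practically uniformly bounded from every $\delta>0$. For a system independent of $\omega$, "practically" is omitted and "semi-globally" becomes "globally". -/

import Mathlib

open Set Filter Topology
open scoped Gradient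

noncomputable section

namespace UnicycleSeeking

section Stability

variable {E : Type*} [NormedAddCommGroup E] [NormedSpace ℝ E]

/-- `x` is a (classical, forward complete) solution of `ẋ = f(t, x)`, `x(t₀) = x₀`, on `[t₀, ∞)`. -/
def IsSolution (f : ℝ → E → E) (t₀ : ℝ) (x₀ : E) (x : ℝ → E) : Prop :=
  x t₀ = x₀ ∧ ∀ t, t₀ ≤ t → HasDerivWithinAt x (f t (x t)) (Ici t₀) t

/-- For initial data `x₀` at time `t₀`, the solution of `ẋ = f(t, x)` exists for all `t ≥ t₀`, and
every solution lies in the `ε`-neighbourhood `B_ε(L_t)` for all `t ≥ t₀ + t₁`. -/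
def StaysNear (f : ℝ → E → E) (L : ℝ → Set E) (ε t₀ t₁ : ℝ) (x₀ : E) : Prop :=
  (∃ x, IsSolution f t₀ x₀ x) ∧
    ∀ x, IsSolution f t₀ x₀ x → ∀ t, t₀ + t₁ ≤ t → x t ∈ Metric.thickening ε (L t)

/-- Practical uniform stability of the family `L` for the systems `ẋ = f ω t x`, `ω > 0`. -/
def PracticallyUniformlyStable (f : ℝ → ℝ → E → E) (L : ℝ → Set E) : Prop :=
  ∀ ε > 0, ∃ δ > 0, ∃ ω₀ > 0, ∀ t₀ ≥ 0, ∀ ω > ω₀,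
    ∀ x₀ ∈ Metric.thickening δ (L t₀), StaysNear (f ω) L ε t₀ 0 x₀

/-- `δ`-practical uniform attractivity. -/
def PracticallyUniformlyAttractive (f : ℝ → ℝ → E → E) (L : ℝ → Set E) (δ : ℝ) : Prop :=
  ∀ ε > 0, ∃ t₁ ≥ 0, ∃ ω₀ > 0, ∀ t₀ ≥ 0, ∀ ω > ω₀,
    ∀ x₀ ∈ Metric.thickening δ (L t₀), StaysNear (f ω) L ε t₀ t₁ x₀

/-- Practical uniform boundedness of the solutions that start in the `δ`-neighbourhood. -/
def PracticallyUniformlyBoundedFrom (f : ℝ → ℝ → E → E) (L : ℝ → Set E) (δ : ℝ) : Prop :=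
  ∃ ε > 0, ∃ ω₀ > 0, ∀ t₀ ≥ 0, ∀ ω > ω₀,
    ∀ x₀ ∈ Metric.thickening δ (L t₀), StaysNear (f ω) L ε t₀ 0 x₀

/-- Local practical uniform asymptotic stability. Attractivity and boundedness are both required
for initial data in some neighbourhood of the family. -/
def LocallyPracticallyUAS (f : ℝ → ℝ → E → E) (L : ℝ → Set E) : Prop :=
  PracticallyUniformlyStable f L ∧
    ∃ δ' > 0, PracticallyUniformlyAttractive f L δ' ∧
      ∀ δ, 0 < δ → δ ≤ δ' → PracticallyUniformlyBoundedFrom f L δ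

/-- Semi-global practical uniform asymptotic stability. -/
def SemigloballyPracticallyUAS (f : ℝ → ℝ → E → E) (L : ℝ → Set E) : Prop :=
  PracticallyUniformlyStable f L ∧
    (∀ δ' > 0, PracticallyUniformlyAttractive f L δ') ∧
      ∀ δ > 0, PracticallyUniformlyBoundedFrom f L δ

/-- Local uniform asymptotic stability for a system that does not depend on `ω`. -/
def LocallyUAS (f : ℝ → E → E) (L : ℝ → Set E) : Prop :=
  LocallyPracticallyUAS (fun _ => f) L

/-- Global uniform asymptotic stability for a system that does not depend on `ω`. -/
def GloballyUAS (f : ℝ → E → E) (L : ℝ → Set E) : Prop :=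
  SemigloballyPracticallyUAS (fun _ => f) L

end Stability

section Assumptions

variable {E : Type*} [NormedAddCommGroup E] [NormedSpace ℝ E]

/-- (A1): the time-dependent vector fields `f₀, …, f_ℓ` (`f₀` is the drift) are of class `C²` on
`[0, ∞) × E`. -/
def AssumptionA1 {l : ℕ} (f : Fin (l + 1) → ℝ → E → E) : Prop :=
  ∀ i, ContDiffOn ℝ 2 (fun p : ℝ × E => f i p.1 p.2) (Ici 0 ×ˢ univ)

/-- (A2): the listed functions are bounded on each compact set of states, uniformly in `t ≥ 0`.
Time derivatives are one-sided at `t = 0`;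
`VectorField.lieBracket ℝ V W x = DW(x) V(x) - DV(x) W(x)`. -/
def AssumptionA2 {l : ℕ} (f : Fin (l + 1) → ℝ → E → E) : Prop :=
  ∀ X : Set E, IsCompact X → ∃ C : ℝ, ∀ t ≥ 0, ∀ x ∈ X,
    (∀ i, ‖f i t x‖ ≤ C ∧
      ‖derivWithin (fun s => f i s x) (Ici 0) t‖ ≤ C ∧
      ‖fderiv ℝ (f i t) x‖ ≤ C) ∧
    (∀ j, j ≠ 0 → ‖derivWithin (fun s => fderiv ℝ (f j s) x) (Ici 0) t‖ ≤ C) ∧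
    (∀ j k, j ≠ 0 → j ≤ k →
      ‖derivWithin (fun s => VectorField.lieBracket ℝ (f j s) (f k s) x) (Ici 0) t‖ ≤ C ∧
      ‖fderiv ℝ (fun y => VectorField.lieBracket ℝ (f j t) (f k t) y) x‖ ≤ C)

end Assumptions

/-- The plane with its Euclidean norm. -/
abbrev Plane : Type := EuclideanSpace ℝ (Fin 2)

/-- The unicycle `ẋ₁ = u cos(Ω t)`, `ẋ₂ = u sin(Ω t)` with a feedback `u = u(t, x)`. -/
def unicycle (Ω : ℝ) (u : ℝ → Plane → ℝ) (t : ℝ) (x : Plane) : Plane :=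
  !₂[u t x * Real.cos (Ω * t), u t x * Real.sin (Ω * t)]

/-- `F₁, F₂` are continuous, the zeros of `F₁` are isolated, and `F₂ = -F₁ ∫ dz / F₁²`, where the
integral stands for an antiderivative of `1 / F₁²` on the open set `{F₁ ≠ 0}`. (At a zero of `F₁`
the value of `F₂` is the limit of `-F₁ ∫ dz / F₁²`, by continuity of `F₂`. The zero set is closed and
discrete, hence countable.) -/
structure IsSeekingPair (F₁ F₂ : ℝ → ℝ) : Prop where
  continuous_fst : Continuous F₁
  continuous_snd : Continuous F₂
  isolated_zeros : ∀ z, F₁ z = 0 → ∀ᶠ y in 𝓝[≠] z, F₁ y ≠ 0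
  antideriv : ∃ Ψ : ℝ → ℝ, ∀ z, F₁ z ≠ 0 →
    HasDerivAt Ψ (1 / F₁ z ^ 2) z ∧ F₂ z = -(F₁ z * Ψ z)

/-- The constant `α = 4 (1 - k⁻²)`. -/
def alpha (k : ℕ) : ℝ := 4 * (1 - 1 / (k : ℝ) ^ 2)

/-- The control `u^ω(t, z) = √(ϑ α ω) (F₁(z) cos(ω t) + F₂(z) sin(ω t))`, where `z` is the measured
value of the cost. -/
def control (k : ℕ) (ϑ : ℝ) (F₁ F₂ : ℝ → ℝ) (ω t z : ℝ) : ℝ :=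
  Real.sqrt (ϑ * alpha k * ω) * (F₁ z * Real.cos (ω * t) + F₂ z * Real.sin (ω * t))

/-- The closed-loop unicycle with `ω = k Ω`, as a family of systems with parameter `ω`. -/
def closedLoop (k : ℕ) (ϑ : ℝ) (F₁ F₂ : ℝ → ℝ) (J : Plane → Plane → ℝ) (γ : ℝ → Plane)
    (ω : ℝ) : ℝ → Plane → Plane :=
  unicycle (ω / k) (fun t x => control k ϑ F₁ F₂ ω t (J x (γ t)))

/-- The drift (zero) and the four vector fields `(F₁(J), 0)`, `(F₂(J), 0)`, `(0, F₁(J))`,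
`(0, F₂(J))` of the closed loop, written as a control-affine system. -/
def fields (F₁ F₂ : ℝ → ℝ) (J : Plane → Plane → ℝ) (γ : ℝ → Plane) :
    Fin 5 → ℝ → Plane → Plane :=
  ![fun _ _ => 0,
    fun t x => !₂[F₁ (J x (γ t)), 0],
    fun t x => !₂[F₂ (J x (γ t)), 0],
    fun t x => !₂[0, F₁ (J x (γ t))],
    fun t x => !₂[0, F₂ (J x (γ t))]]

/-- `φ = (1 / 2k) ∇ₓ (F₁²(J(x, c)) + F₂²(J(x, c)))`. -/
def phi (k : ℕ) (F₁ F₂ : ℝ → ℝ) (J : Plane → Plane → ℝ) (c x : Plane) : Plane :=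
  (1 / (2 * (k : ℝ))) • ∇ (fun y => F₁ (J y c) ^ 2 + F₂ (J y c) ^ 2) x

/-- `Φ = (-φ₂, φ₁)`. -/
def rotationalPart (k : ℕ) (F₁ F₂ : ℝ → ℝ) (J : Plane → Plane → ℝ) (c x : Plane) : Plane :=
  !₂[-(phi k F₁ F₂ J c x 1), phi k F₁ F₂ J c x 0]

/-- Right-hand side `-ϑ (∇ₓ J(x, γ(t)) + Φ(x, γ(t)))` of the Lie bracket system of the closed
loop. The factor `-ϑ` of `Φ` comes from the mean over one period of the products
`(∫ vᵢ) vⱼ` of the inputs, which is `-1 / (k α)` for the pairs `(1, 3)` and `(2, 4)`. -/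
def lieSystem (k : ℕ) (ϑ : ℝ) (F₁ F₂ : ℝ → ℝ) (J : Plane → Plane → ℝ) (γ : ℝ → Plane)
    (t : ℝ) (x : Plane) : Plane :=
  -(ϑ • (∇ (fun y => J y (γ t)) x + rotationalPart k F₁ F₂ J (γ t) x))

/-- The level set `L_{λ,t} = {x : J(x, γ(t)) - J(x*(γ(t)), γ(t)) ≤ λ}`. -/
def levelSet (J : Plane → Plane → ℝ) (xmin : Plane → Plane) (γ : ℝ → Plane) (lam t : ℝ) :
    Set Plane :=
  {x | J x (γ t) - J (xmin (γ t)) (γ t) ≤ lam}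

end UnicycleSeeking

end

/-!
The closed loop is a control-affine system `ẋ = √ω ∑ᵢ vᵢ(ωt) fᵢ(t, x)` whose inputs are sums of two
tones, of the frequencies `1 ± 1/k`. They have bounded primitives `Vᵢ`, and each product `Vᵢ vⱼ` is
the sum of its mean `mᵢⱼ` and of the derivative of a bounded function `Wᵢⱼ`. Along a trajectory, the
near-identity change of variables
`z = x - ω^(-1/2) ∑ᵢ Vᵢ(ωt) fᵢ + ω⁻¹ ∑ᵢⱼ Wᵢⱼ(ωt) Dfᵢ fⱼ`
therefore satisfies `ż = -∑ᵢⱼ mᵢⱼ Dfᵢ fⱼ + O(ω^(-1/2))`, uniformly in time on bounded sets of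
states, and Grönwall's inequality shows that `x` follows the averaged system on bounded time
intervals, with an error that does not depend on the initial time
(`approximates_of_bounded_primitives`).

The averaged field is the Lie bracket system (`lieSystem_eq_sum`): the matrix `m` is antisymmetric,
the brackets of `F₁(J) e_a` and `F₂(J) e_a` give `-∂ₐJ e_a` by the Wronskian identity
(`IsSeekingPair.wronskian`), and those of the fields along different axes give the rotational part.

The `O(ω^(-1/2))` needs the functions `Dfᵢ fⱼ` to have bounded derivatives, whereas only brackets
are assumed to have them. The fields here are multiples `h_s e_a` of the unit vectors, and the two
coordinates of the bracket of `h_s e_0` and `h_s' e_1` are, up to sign, `h_s' ∂₁h_s` and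
`h_s ∂₀h_s'`. As `s` and `s'` vary, these are the coefficients of all the `Dfᵢ fⱼ`
(`norm_fderiv_dirDeriv_axisField_le`).

Closeness on bounded time intervals transfers stability: a trajectory of the averaged system that
starts in the `δ`-neighbourhood of the level set is in its `δ/2`-neighbourhood after a fixed time,
so for large `ω` the trajectory of the closed loop returns to the `δ`-neighbourhood then, and the
argument repeats (`staysNear_of_approximates`). Forward completeness of the closed loop comes with
it: a cutoff of the vector field has global solutions by Picard–Lindelöf, and the estimates keep
them where the cutoff is `1`.
-/

noncomputable section

namespace UnicycleSeeking

/-! ### Transfer of stability from a limit system -/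

section Transfer

lemma mem_thickening_of_dist_lt {X : Type*} [PseudoMetricSpace X] {s : Set X} {a b : ℝ}
    {x y : X} (hy : y ∈ Metric.thickening a s)
    (hxy : dist x y < b) : x ∈ Metric.thickening (a + b) s := by
  obtain ⟨z, hz, hyz⟩ := Metric.mem_thickening_iff.1 hy
  exact Metric.mem_thickening_iff.2 ⟨z, hz, by linarith [dist_triangle x y z]⟩

lemma norm_lt_of_mem_thickening {X : Type*} [SeminormedAddCommGroup X] {s : Set X}
    {R a : ℝ} {x : X} (hs : ∀ z ∈ s, ‖z‖ ≤ R)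
    (hx : x ∈ Metric.thickening a s) : ‖x‖ < R + a := by
  obtain ⟨z, hz, hxz⟩ := Metric.mem_thickening_iff.1 hx
  rw [dist_eq_norm] at hxz
  linarith [hs z hz, norm_le_norm_add_norm_sub' x z]

variable {E : Type*} [NormedAddCommGroup E] [NormedSpace ℝ E]

/-- A continuous curve on `[t₀, ∞)` that satisfies `ẋ = f(t, x)` at the times at which it lies
in `U`. Such curves exist for all time even if solutions may blow up outside `U`, and a curve of
this kind that never leaves `U` is a solution. -/
structure IsSolutionOn (U : Set E) (f : ℝ → E → E) (t₀ : ℝ) (x₀ : E) (x : ℝ → E) : Prop where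
  init : x t₀ = x₀
  cont : ContinuousOn x (Ici t₀)
  deriv : ∀ t, t₀ ≤ t → x t ∈ U → HasDerivWithinAt x (f t (x t)) (Ici t₀) t

lemma IsSolution.isSolutionOn {f : ℝ → E → E} {t₀ : ℝ} {x₀ : E} {x : ℝ → E}
    (h : IsSolution f t₀ x₀ x) (U : Set E) : IsSolutionOn U f t₀ x₀ x :=
  ⟨h.1, fun t ht => (h.2 t ht).continuousWithinAt, fun t ht _ => h.2 t ht⟩

lemma IsSolutionOn.isSolution {U : Set E} {f : ℝ → E → E} {t₀ : ℝ} {x₀ : E} {x : ℝ → E}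
    (h : IsSolutionOn U f t₀ x₀ x) (hU : ∀ t, t₀ ≤ t → x t ∈ U) : IsSolution f t₀ x₀ x :=
  ⟨h.init, fun t ht => h.deriv t ht (hU t ht)⟩

lemma IsSolutionOn.restart {U : Set E} {f : ℝ → E → E} {t₀ s : ℝ} {x₀ : E} {x : ℝ → E}
    (h : IsSolutionOn U f t₀ x₀ x) (hs : t₀ ≤ s) : IsSolutionOn U f s (x s) x :=
  ⟨rfl, h.cont.mono (Ici_subset_Ici.2 hs),
    fun t ht hx => (h.deriv t (hs.trans ht) hx).mono (Ici_subset_Ici.2 hs)⟩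

lemma IsSolution.restart {f : ℝ → E → E} {t₀ s : ℝ} {x₀ : E} {x : ℝ → E}
    (h : IsSolution f t₀ x₀ x) (hs : t₀ ≤ s) : IsSolution f s (x s) x :=
  ⟨rfl, fun t ht => (h.2 t (hs.trans ht)).mono (Ici_subset_Ici.2 hs)⟩

/-- On bounded sets and finite time intervals, the trajectories of `ẋ = f ω t x` converge to those
of `ẋ = G t x` as `ω → ∞`, uniformly in the initial time `t₀ ≥ 0`. -/
def Approximates (f : ℝ → ℝ → E → E) (G : ℝ → E → E) : Prop :=
  ∀ R T D : ℝ, 0 < D → ∃ ω₀ > 0, ∀ ω > ω₀, ∀ t₀ ≥ 0, ∀ (x₀ : E) (y x : ℝ → E),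
    IsSolution G t₀ x₀ y → (∀ t ∈ Icc t₀ (t₀ + T), ‖y t‖ ≤ R) →
    IsSolutionOn (Metric.ball 0 (R + 1)) (f ω) t₀ x₀ x →
    ∀ t ∈ Icc t₀ (t₀ + T), dist (x t) (y t) < D

/-- Every initial value problem has a curve on `[t₀, ∞)` that solves it inside a given ball. -/
def LocallySolvable (f : ℝ → ℝ → E → E) : Prop :=
  ∀ ω > 0, ∀ ρ : ℝ, ∀ t₀ ≥ 0, ∀ x₀ : E, ∃ x, IsSolutionOn (Metric.ball 0 ρ) (f ω) t₀ x₀ x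

variable {f : ℝ → ℝ → E → E} {G : ℝ → E → E} {L : ℝ → Set E}

/-- If the limit system maps the `δ`-neighbourhood of `L` into its `δ / 2`-neighbourhood after a
fixed time, and meanwhile stays in the `ε₁`-neighbourhood, then, for large `ω`, the trajectories
of the approximating systems return to the `δ`-neighbourhood after each time step, and so never
leave the `ε`-neighbourhood, `ε > ε₁`. -/
lemma staysNear_of_approximates (hfG : Approximates f G) (hsol : LocallySolvable f) {R₀ : ℝ}
    (hL : ∀ t ≥ 0, ∀ z ∈ L t, ‖z‖ ≤ R₀) {δ ε₁ ε t₁ : ℝ} (hδ : 0 < δ) (hε : ε₁ < ε)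
    (hstay : ∀ t₀ ≥ 0, ∀ x₀ ∈ Metric.thickening δ (L t₀), StaysNear G L ε₁ t₀ 0 x₀)
    (hattr : ∀ t₀ ≥ 0, ∀ x₀ ∈ Metric.thickening δ (L t₀), StaysNear G L (δ / 2) t₀ t₁ x₀) :
    ∃ ω₀ > 0, ∀ t₀ ≥ 0, ∀ ω > ω₀, ∀ x₀ ∈ Metric.thickening δ (L t₀),
      StaysNear (f ω) L ε t₀ 0 x₀ := by
  -- a time step of positive length, so that its multiples exhaust the half-line
  set T := max t₁ 1
  have hT1 : 1 ≤ T := le_max_right _ _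
  obtain ⟨ω₀, hω₀, H⟩ := hfG (R₀ + ε) T (min (ε - ε₁) (δ / 2))
    (lt_min (by linarith) (by linarith))
  refine ⟨ω₀, hω₀, fun t₀ ht₀ ω hω x₀ hx₀ => ?_⟩
  have step : ∀ s ≥ 0, ∀ (z : E) (x : ℝ → E), z ∈ Metric.thickening δ (L s) →
      IsSolutionOn (Metric.ball 0 (R₀ + ε + 1)) (f ω) s z x →
      (∀ t ∈ Icc s (s + T), x t ∈ Metric.thickening ε (L t)) ∧
        x (s + T) ∈ Metric.thickening δ (L (s + T)) := by
    intro s hs z x hz hx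
    obtain ⟨⟨y, hy⟩, hy1⟩ := hstay s hs z hz
    have hyε : ∀ t, s ≤ t → y t ∈ Metric.thickening ε₁ (L t) := fun t ht =>
      hy1 y hy t (by linarith)
    have hyδ := (hattr s hs z hz).2 y hy (s + T) (by linarith [le_max_left t₁ 1])
    have hd := H ω hω s hs z y x hy
      (fun t ht => ((norm_lt_of_mem_thickening (hL t (hs.trans ht.1)) (hyε t ht.1)).trans
        (by linarith)).le) hx
    refine ⟨fun t ht => ?_, ?_⟩
    · have := mem_thickening_of_dist_lt (hyε t ht.1) ((hd t ht).trans_le (min_le_left _ _))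
      rwa [add_sub_cancel] at this
    · have := mem_thickening_of_dist_lt hyδ
        ((hd (s + T) ⟨by linarith, le_rfl⟩).trans_le (min_le_right _ _))
      rwa [add_halves] at this
  -- every curve that solves the equation inside the ball, whether or not it might leave it
  have all : ∀ x, IsSolutionOn (Metric.ball 0 (R₀ + ε + 1)) (f ω) t₀ x₀ x →
      ∀ t, t₀ ≤ t → x t ∈ Metric.thickening ε (L t) := by
    intro x hx
    have hn : ∀ n : ℕ, x (t₀ + n * T) ∈ Metric.thickening δ (L (t₀ + n * T)) := by
      intro n
      induction n with
      | zero => simpa [hx.init] using hx₀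
      | succ n ih =>
        have h0 : 0 ≤ n * T := by positivity
        have := (step _ (by linarith) _ x ih (hx.restart (by linarith))).2
        convert this using 2 <;> push_cast <;> ring_nf
    intro t ht
    have hq : 0 ≤ (t - t₀) / T := div_nonneg (by linarith) (by linarith)
    set n := ⌊(t - t₀) / T⌋₊
    have h1 : n * T ≤ t - t₀ := (le_div_iff₀ (by linarith)).1 (Nat.floor_le hq)
    have h2 : t - t₀ < (n + 1) * T := (div_lt_iff₀ (by linarith)).1 (Nat.lt_floor_add_one _)
    have h0 : 0 ≤ n * T := by positivity
    exact (step _ (by linarith) _ x (hn n) (hx.restart (by linarith))).1 t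
      ⟨by linarith, by linarith⟩
  constructor
  · obtain ⟨x, hx⟩ := hsol ω (hω₀.trans hω) (R₀ + ε + 1) t₀ ht₀ x₀
    refine ⟨x, hx.isSolution fun t ht => ?_⟩
    have := norm_lt_of_mem_thickening (hL t (ht₀.trans ht)) (all x hx t ht)
    rw [mem_ball_zero_iff]
    linarith
  · exact fun x hx t ht => all x (hx.isSolutionOn _) t (by linarith)

lemma practicallyUniformlyStable_of_approximates (hfG : Approximates f G) (hsol : LocallySolvable f)
    {R₀ : ℝ} (hL : ∀ t ≥ 0, ∀ z ∈ L t, ‖z‖ ≤ R₀) {δ : ℝ} (hδ : 0 < δ)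
    (hs : PracticallyUniformlyStable (fun _ => G) L)
    (ha : PracticallyUniformlyAttractive (fun _ => G) L δ) : PracticallyUniformlyStable f L := by
  intro ε hε
  obtain ⟨δ₁, hδ₁, ω₁, -, H₁⟩ := hs (ε / 2) (by linarith)
  have hm : 0 < min δ δ₁ := lt_min hδ hδ₁
  obtain ⟨t₁, -, ω₂, -, H₂⟩ := ha (min δ δ₁ / 2) (by linarith)
  obtain ⟨ω₀, hω₀, H⟩ := staysNear_of_approximates hfG hsol hL hm (half_lt_self hε)
    (fun t₀ ht₀ x₀ hx₀ => H₁ t₀ ht₀ (ω₁ + 1) (by linarith) x₀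
      (Metric.thickening_mono (min_le_right _ _) _ hx₀))
    (fun t₀ ht₀ x₀ hx₀ => H₂ t₀ ht₀ (ω₂ + 1) (by linarith) x₀
      (Metric.thickening_mono (min_le_left _ _) _ hx₀))
  exact ⟨_, hm, ω₀, hω₀, H⟩

lemma practicallyUniformlyBoundedFrom_of_approximates (hfG : Approximates f G)
    (hsol : LocallySolvable f) {R₀ : ℝ} (hL : ∀ t ≥ 0, ∀ z ∈ L t, ‖z‖ ≤ R₀) {δ : ℝ} (hδ : 0 < δ)
    (ha : PracticallyUniformlyAttractive (fun _ => G) L δ)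
    (hb : PracticallyUniformlyBoundedFrom (fun _ => G) L δ) :
    PracticallyUniformlyBoundedFrom f L δ := by
  obtain ⟨ε, hε, ω₁, -, H₁⟩ := hb
  obtain ⟨t₁, -, ω₂, -, H₂⟩ := ha (δ / 2) (by linarith)
  obtain ⟨ω₀, hω₀, H⟩ := staysNear_of_approximates hfG hsol hL hδ (lt_add_one ε)
    (fun t₀ ht₀ x₀ hx₀ => H₁ t₀ ht₀ (ω₁ + 1) (by linarith) x₀ hx₀)
    (fun t₀ ht₀ x₀ hx₀ => H₂ t₀ ht₀ (ω₂ + 1) (by linarith) x₀ hx₀)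
  exact ⟨ε + 1, by linarith, ω₀, hω₀, H⟩

/-- A trajectory first follows the limit system into the neighbourhood that practical stability
asks for, and is then kept close to `L` by practical stability. -/
lemma practicallyUniformlyAttractive_of_approximates (hfG : Approximates f G)
    (hsol : LocallySolvable f) {R₀ : ℝ} (hL : ∀ t ≥ 0, ∀ z ∈ L t, ‖z‖ ≤ R₀) {δ : ℝ} (hδ : 0 < δ)
    (hs : PracticallyUniformlyStable f L)
    (ha : PracticallyUniformlyAttractive (fun _ => G) L δ)
    (hb : PracticallyUniformlyBoundedFrom (fun _ => G) L δ) :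
    PracticallyUniformlyAttractive f L δ := by
  intro ε hε
  obtain ⟨δ₂, hδ₂, ω₂, hω₂, H₂⟩ := hs ε hε
  obtain ⟨ε₃, hε₃, ω₃, -, H₃⟩ :=
    practicallyUniformlyBoundedFrom_of_approximates hfG hsol hL hδ ha hb
  obtain ⟨ε₁, hε₁, ω₁, -, H₁⟩ := hb
  obtain ⟨t₁, ht₁, ω₄, -, H₄⟩ := ha (δ₂ / 2) (by linarith)
  obtain ⟨ω₀, hω₀, H⟩ := hfG (R₀ + ε₁) t₁ (δ₂ / 2) (by linarith)
  refine ⟨t₁, ht₁, max ω₀ (max ω₂ ω₃), lt_max_of_lt_left hω₀, fun t₀ ht₀ ω hω x₀ hx₀ => ?_⟩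
  simp only [gt_iff_lt, max_lt_iff] at hω
  refine ⟨(H₃ t₀ ht₀ ω hω.2.2 x₀ hx₀).1, fun x hx t ht => ?_⟩
  obtain ⟨⟨y, hy⟩, hy1⟩ := H₁ t₀ ht₀ (ω₁ + 1) (by linarith) x₀ hx₀
  have hyδ := (H₄ t₀ ht₀ (ω₄ + 1) (by linarith) x₀ hx₀).2 y hy (t₀ + t₁) le_rfl
  have hd := H ω hω.1 t₀ ht₀ x₀ y x hy
    (fun t ht => (norm_lt_of_mem_thickening (hL t (ht₀.trans ht.1))
      (hy1 y hy t (by linarith [ht.1]))).le) (hx.isSolutionOn _) (t₀ + t₁) ⟨by linarith, le_rfl⟩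
  have hmem := mem_thickening_of_dist_lt hyδ hd
  rw [add_halves] at hmem
  exact (H₂ (t₀ + t₁) (by linarith) ω hω.2.1 _ hmem).2 x (hx.restart (by linarith)) t (by linarith)

lemma PracticallyUniformlyAttractive.mono {δ δ' : ℝ} (h : PracticallyUniformlyAttractive f L δ')
    (hδ : δ ≤ δ') : PracticallyUniformlyAttractive f L δ := by
  intro ε hε
  obtain ⟨t₁, ht₁, ω₀, hω₀, H⟩ := h ε hε
  exact ⟨t₁, ht₁, ω₀, hω₀, fun t₀ ht₀ ω hω x₀ hx₀ =>
    H t₀ ht₀ ω hω x₀ (Metric.thickening_mono hδ _ hx₀)⟩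

theorem locallyPracticallyUAS_of_approximates (hfG : Approximates f G) (hsol : LocallySolvable f)
    {R₀ : ℝ} (hL : ∀ t ≥ 0, ∀ z ∈ L t, ‖z‖ ≤ R₀) (h : LocallyUAS G L) :
    LocallyPracticallyUAS f L := by
  obtain ⟨hs, δ', hδ', ha, hb⟩ := h
  have hs' := practicallyUniformlyStable_of_approximates hfG hsol hL hδ' hs ha
  exact ⟨hs', δ', hδ', practicallyUniformlyAttractive_of_approximates hfG hsol hL hδ' hs' ha
    (hb δ' hδ' le_rfl), fun δ hδ hδδ => practicallyUniformlyBoundedFrom_of_approximates hfG hsol hL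
      hδ (ha.mono hδδ) (hb δ hδ hδδ)⟩

theorem semigloballyPracticallyUAS_of_approximates (hfG : Approximates f G)
    (hsol : LocallySolvable f) {R₀ : ℝ} (hL : ∀ t ≥ 0, ∀ z ∈ L t, ‖z‖ ≤ R₀)
    (h : GloballyUAS G L) : SemigloballyPracticallyUAS f L := by
  obtain ⟨hs, ha, hb⟩ := h
  have hs' := practicallyUniformlyStable_of_approximates hfG hsol hL one_pos hs (ha 1 one_pos)
  exact ⟨hs', fun δ hδ => practicallyUniformlyAttractive_of_approximates hfG hsol hL hδ hs'
    (ha δ hδ) (hb δ hδ), fun δ hδ => practicallyUniformlyBoundedFrom_of_approximates hfG hsol hL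
      hδ (ha δ hδ) (hb δ hδ)⟩

end Transfer

/-! ### Global solutions of a truncated equation -/

section Cutoff

variable {E : Type*} [SeminormedAddCommGroup E]

/-- A Lipschitz cutoff that is `1` on the ball of radius `ρ` and `0` off the ball of radius
`ρ + 1`. -/
def cutoff (ρ : ℝ) (x : E) : ℝ := max 0 (min 1 (ρ + 1 - ‖x‖))

lemma cutoff_nonneg (ρ : ℝ) (x : E) : 0 ≤ cutoff ρ x := le_max_left _ _

lemma cutoff_le_one (ρ : ℝ) (x : E) : cutoff ρ x ≤ 1 :=
  max_le zero_le_one (min_le_left _ _)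

lemma cutoff_eq_one {ρ : ℝ} {x : E} (h : ‖x‖ ≤ ρ) : cutoff ρ x = 1 := by
  rw [cutoff, min_eq_left (by linarith), max_eq_right zero_le_one]

lemma cutoff_eq_zero {ρ : ℝ} {x : E} (h : ρ + 1 < ‖x‖) : cutoff ρ x = 0 :=
  max_eq_left ((min_le_right _ _).trans (by linarith))

lemma abs_cutoff_sub_le (ρ : ℝ) (x y : E) : |cutoff ρ x - cutoff ρ y| ≤ ‖x - y‖ := by
  refine (abs_max_sub_max_le_max _ _ _ _).trans ?_
  refine max_le (by simp) ((abs_min_sub_min_le_max _ _ _ _).trans (max_le (by simp) ?_))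
  rw [sub_sub_sub_cancel_left, abs_sub_comm]
  exact abs_norm_sub_norm_le x y

end Cutoff

section Existence

variable {E : Type*} [NormedAddCommGroup E] [NormedSpace ℝ E]

open scoped NNReal

/-- A bounded, globally Lipschitz vector field that is continuous in time has forward complete
solutions: Picard–Lindelöf on a ball whose radius grows with the length of the time interval. -/
lemma exists_isSolution_of_lipschitz [CompleteSpace E] {f : ℝ → E → E} {t₀ : ℝ} {K C : ℝ≥0}
    (hlip : ∀ t ≥ t₀, LipschitzWith K (f t)) (hb : ∀ t ≥ t₀, ∀ x, ‖f t x‖ ≤ C)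
    (hc : ∀ x, ContinuousOn (fun t => f t x) (Ici t₀)) (x₀ : E) : ∃ x, IsSolution f t₀ x₀ x := by
  have hex : ∀ n : ℕ, ∃ α : ℝ → E, α t₀ = x₀ ∧
      ∀ t ∈ Icc t₀ (t₀ + n), HasDerivWithinAt α (f t (α t)) (Icc t₀ (t₀ + n)) t := by
    intro n
    have hn : t₀ ≤ t₀ + n := by simp
    have hpl : IsPicardLindelof f (tmin := t₀) (tmax := t₀ + n) ⟨t₀, le_rfl, hn⟩ x₀
        (C * n) 0 C K :=
      { lipschitzOnWith := fun t ht => (hlip t ht.1).lipschitzOnWith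
        continuousOn := fun x _ => (hc x).mono Icc_subset_Ici_self
        norm_le := fun t ht x _ => hb t ht.1 x
        mul_max_le := by simp }
    exact hpl.exists_eq_forall_mem_Icc_hasDerivWithinAt (x := x₀) (by simp)
  choose α hα0 hα using hex
  have huniq : ∀ m n : ℕ, m ≤ n → EqOn (α m) (α n) (Icc t₀ (t₀ + m)) := by
    intro m n hmn
    have hmn' : (m : ℝ) ≤ n := by exact_mod_cast hmn
    have hsub : Icc t₀ (t₀ + m) ⊆ Icc t₀ (t₀ + n) := Icc_subset_Icc_right (by linarith)
    have hd : ∀ k : ℕ, m ≤ k → ∀ t ∈ Ico t₀ (t₀ + m),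
        HasDerivWithinAt (α k) (f t (α k t)) (Ici t) t := by
      intro k hk t ht
      have hk' : (m : ℝ) ≤ k := by exact_mod_cast hk
      refine (hα k t ⟨ht.1, by linarith [ht.2]⟩).mono_of_mem_nhdsWithin ?_
      filter_upwards [self_mem_nhdsWithin, nhdsWithin_le_nhds (Iio_mem_nhds ht.2)] with s h1 h2
      exact ⟨ht.1.trans h1, by linarith [mem_Iio.1 h2]⟩
    exact ODE_solution_unique_of_mem_Icc_right (v := f) (s := fun _ => univ) (K := K)
      (fun t ht => (hlip t ht.1).lipschitzOnWith)
      (fun t ht => (hα m t ht).continuousWithinAt) (hd m le_rfl) (fun _ _ => mem_univ _)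
      (fun t ht => ((hα n t (hsub ht)).continuousWithinAt).mono hsub) (hd n hmn)
      (fun _ _ => mem_univ _) (by rw [hα0, hα0])
  have hagree : ∀ m n : ℕ, ∀ t, t₀ ≤ t → t ≤ t₀ + m → t ≤ t₀ + n → α m t = α n t := by
    intro m n t h0 hm hn
    rcases le_total m n with h | h
    · exact huniq m n h ⟨h0, hm⟩
    · exact (huniq n m h ⟨h0, hn⟩).symm
  have hfl : ∀ t, t < t₀ + ((⌊t - t₀⌋₊ + 1 : ℕ) : ℝ) := by
    intro t
    have := Nat.lt_floor_add_one (t - t₀)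
    push_cast
    linarith
  -- near `t` the glued curve agrees with `α n` for the fixed `n = ⌊t - t₀⌋₊ + 1`
  refine ⟨fun t => α (⌊t - t₀⌋₊ + 1) t, by simp [hα0], fun t ht => ?_⟩
  set n := ⌊t - t₀⌋₊ + 1
  have hnhds : Iio (t₀ + (n : ℝ)) ∈ 𝓝[Ici t₀] t := nhdsWithin_le_nhds (Iio_mem_nhds (hfl t))
  have hder : HasDerivWithinAt (α n) (f t (α n t)) (Ici t₀) t := by
    refine (hα n t ⟨ht, (hfl t).le⟩).mono_of_mem_nhdsWithin ?_
    filter_upwards [self_mem_nhdsWithin, hnhds] with s h1 h2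
    exact ⟨h1, (mem_Iio.1 h2).le⟩
  refine hder.congr_of_eventuallyEq ?_ rfl
  filter_upwards [self_mem_nhdsWithin, hnhds] with s h1 h2
  exact hagree _ _ s h1 (hfl s).le (mem_Iio.1 h2).le

lemma lipschitzWith_cutoff_smul {ρ : ℝ} {K C : ℝ≥0} {f : E → E}
    (hlip : LipschitzOnWith K f (Metric.closedBall 0 (ρ + 1)))
    (hb : ∀ x ∈ Metric.closedBall (0 : E) (ρ + 1), ‖f x‖ ≤ C) :
    LipschitzWith (K + C) (fun x => cutoff ρ x • f x) := by
  have key : ∀ x y : E, ‖x‖ ≤ ρ + 1 →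
      ‖cutoff ρ x • f x - cutoff ρ y • f y‖ ≤ (K + C) * ‖x - y‖ := by
    intro x y hx
    have hfx := hb x (by simpa using hx)
    have hχ := abs_cutoff_sub_le ρ x y
    rcases le_or_gt ‖y‖ (ρ + 1) with hy | hy
    · have h1 : cutoff ρ x • f x - cutoff ρ y • f y =
          (cutoff ρ x - cutoff ρ y) • f x + cutoff ρ y • (f x - f y) := by module
      have h2 : ‖f x - f y‖ ≤ K * ‖x - y‖ := by
        simpa [dist_eq_norm] using hlip.dist_le_mul x (by simpa using hx) y (by simpa using hy)
      rw [h1]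
      refine (norm_add_le _ _).trans ?_
      rw [norm_smul, norm_smul, Real.norm_eq_abs, Real.norm_eq_abs,
        abs_of_nonneg (cutoff_nonneg ρ y)]
      have h3 : |cutoff ρ x - cutoff ρ y| * ‖f x‖ ≤ ‖x - y‖ * C := by gcongr
      have h4 : cutoff ρ y * ‖f x - f y‖ ≤ 1 * (K * ‖x - y‖) := by
        gcongr
        exact cutoff_le_one ρ y
      linarith
    · have hz := cutoff_eq_zero hy
      rw [hz, sub_zero] at hχ
      rw [hz, zero_smul, sub_zero, norm_smul, Real.norm_eq_abs]
      have h3 : |cutoff ρ x| * ‖f x‖ ≤ ‖x - y‖ * C := by gcongr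
      have h4 : 0 ≤ K * ‖x - y‖ := by positivity
      linarith
  refine LipschitzWith.of_dist_le_mul fun x y => ?_
  rw [dist_eq_norm, dist_eq_norm, NNReal.coe_add]
  rcases le_or_gt ‖x‖ (ρ + 1) with hx | hx
  · exact key x y hx
  rcases le_or_gt ‖y‖ (ρ + 1) with hy | hy
  · rw [norm_sub_rev, norm_sub_rev x]
    exact key y x hy
  · rw [cutoff_eq_zero hx, cutoff_eq_zero hy, zero_smul, zero_smul, sub_zero, norm_zero]
    positivity

/-- Multiplication of the vector field by a cutoff makes Picard–Lindelöf applicable for all time. -/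
lemma exists_isSolutionOn_ball [CompleteSpace E] {f : ℝ → E → E} {t₀ ρ : ℝ} {K C : ℝ≥0}
    (hlip : ∀ t ≥ t₀, LipschitzOnWith K (f t) (Metric.closedBall 0 (ρ + 1)))
    (hb : ∀ t ≥ t₀, ∀ x ∈ Metric.closedBall (0 : E) (ρ + 1), ‖f t x‖ ≤ C)
    (hc : ∀ x, ContinuousOn (fun t => f t x) (Ici t₀)) (x₀ : E) :
    ∃ x, IsSolutionOn (Metric.ball 0 ρ) f t₀ x₀ x := by
  obtain ⟨x, hx⟩ := exists_isSolution_of_lipschitz (f := fun t x => cutoff ρ x • f t x) (t₀ := t₀)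
    (K := K + C) (C := C) (fun t ht => lipschitzWith_cutoff_smul (hlip t ht) (hb t ht))
    (fun t ht x => by
      rw [norm_smul, Real.norm_eq_abs, abs_of_nonneg (cutoff_nonneg ρ x)]
      rcases le_or_gt ‖x‖ (ρ + 1) with h | h
      · have h1 := hb t ht x (by simpa using h)
        have := mul_le_mul (cutoff_le_one ρ x) h1 (norm_nonneg _) zero_le_one
        linarith
      · rw [cutoff_eq_zero h, zero_mul]
        exact C.2)
    (fun x => (hc x).const_smul _) x₀
  refine ⟨x, hx.1, fun t ht => (hx.2 t ht).continuousWithinAt, fun t ht hxt => ?_⟩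
  have := hx.2 t ht
  dsimp only at this
  rwa [cutoff_eq_one (mem_ball_zero_iff.1 hxt).le, one_smul] at this

end Existence

/-! ### Uniformly tame functions and a Grönwall comparison -/

section Averaging

variable {E F : Type*} [NormedAddCommGroup E] [NormedSpace ℝ E]
  [NormedAddCommGroup F] [NormedSpace ℝ F]

/-- `φ(t, x)` is differentiable on `[0, ∞) × E`, and `φ` and its total derivative are bounded on
each bounded set of states, uniformly in `t ≥ 0`. -/
structure UniformlyTame (φ : ℝ → E → F) : Prop where
  diff : DifferentiableOn ℝ (fun p : ℝ × E => φ p.1 p.2) (Ici 0 ×ˢ univ)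
  bound : ∀ R : ℝ, ∃ C : ℝ, ∀ t ≥ 0, ∀ x : E, ‖x‖ ≤ R → ‖φ t x‖ ≤ C ∧
    ‖fderivWithin ℝ (fun p : ℝ × E => φ p.1 p.2) (Ici 0 ×ˢ univ) (t, x)‖ ≤ C

/-- The state derivative is the restriction of the total derivative. -/
lemma hasFDerivAt_of_differentiableOn {φ : ℝ → E → F}
    (h : DifferentiableOn ℝ (fun p : ℝ × E => φ p.1 p.2) (Ici 0 ×ˢ univ)) {t : ℝ} (ht : 0 ≤ t)
    (x : E) : HasFDerivAt (φ t) ((fderivWithin ℝ (fun p : ℝ × E => φ p.1 p.2) (Ici 0 ×ˢ univ)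
      (t, x)).comp (ContinuousLinearMap.inr ℝ ℝ E)) x := by
  have h1 := (h (t, x) ⟨ht, mem_univ _⟩).hasFDerivWithinAt
  have h2 : HasFDerivWithinAt (fun y : E => (t, y)) (ContinuousLinearMap.inr ℝ ℝ E) univ x :=
    (hasFDerivAt_prodMk_right t x).hasFDerivWithinAt
  exact hasFDerivWithinAt_univ.1 (h1.comp x h2 fun y _ => ⟨ht, mem_univ _⟩)

/-- The time derivative is the restriction of the total derivative. -/
lemma hasDerivWithinAt_of_differentiableOn {φ : ℝ → E → F}
    (h : DifferentiableOn ℝ (fun p : ℝ × E => φ p.1 p.2) (Ici 0 ×ˢ univ)) {t : ℝ} (ht : 0 ≤ t)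
    (x : E) : HasDerivWithinAt (fun s => φ s x) (fderivWithin ℝ (fun p : ℝ × E => φ p.1 p.2)
      (Ici 0 ×ˢ univ) (t, x) (1, 0)) (Ici 0) t := by
  have h1 := (h (t, x) ⟨ht, mem_univ _⟩).hasFDerivWithinAt
  have h2 : HasDerivWithinAt (fun s : ℝ => (s, x)) (1, 0) (Ici 0) t :=
    (hasDerivWithinAt_id t _).prodMk (hasDerivWithinAt_const t _ x)
  have h3 : MapsTo (fun s : ℝ => (s, x)) (Ici 0) (Ici 0 ×ˢ univ) := fun s hs => ⟨hs, mem_univ _⟩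
  exact h1.comp_hasDerivWithinAt t h2 h3

/-- The total derivative is controlled by the two partial derivatives. -/
lemma norm_fderivWithin_le_of_partial {φ : ℝ → E → F}
    (h : DifferentiableOn ℝ (fun p : ℝ × E => φ p.1 p.2) (Ici 0 ×ˢ univ)) {t : ℝ} (ht : 0 ≤ t)
    {x : E} {C : ℝ} (hC : 0 ≤ C) (h1 : ‖derivWithin (fun s => φ s x) (Ici 0) t‖ ≤ C)
    (h2 : ‖fderiv ℝ (φ t) x‖ ≤ C) :
    ‖fderivWithin ℝ (fun p : ℝ × E => φ p.1 p.2) (Ici 0 ×ˢ univ) (t, x)‖ ≤ 2 * C := by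
  rw [(hasDerivWithinAt_of_differentiableOn h ht x).derivWithin (uniqueDiffOn_Ici 0 t ht)] at h1
  rw [(hasFDerivAt_of_differentiableOn h ht x).fderiv] at h2
  set A := fderivWithin ℝ (fun p : ℝ × E => φ p.1 p.2) (Ici 0 ×ˢ univ) (t, x)
  refine A.opNorm_le_bound (by linarith) fun p => ?_
  have e : A p = p.1 • A (1, 0) + A.comp (ContinuousLinearMap.inr ℝ ℝ E) p.2 := by
    rw [← map_smul, ContinuousLinearMap.comp_apply, ContinuousLinearMap.inr_apply, ← map_add]
    simp
  rw [e]
  refine (norm_add_le _ _).trans ?_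
  rw [norm_smul]
  have h3 := (A.comp (ContinuousLinearMap.inr ℝ ℝ E)).le_of_opNorm_le h2 p.2
  have h4 : ‖p.1‖ * ‖A (1, 0)‖ ≤ ‖p‖ * C := by
    gcongr
    exact norm_fst_le p
  have h5 : C * ‖p.2‖ ≤ C * ‖p‖ := by
    gcongr
    exact norm_snd_le p
  linarith

lemma UniformlyTame.hasDerivWithinAt_comp {φ : ℝ → E → F} (h : UniformlyTame φ) {t : ℝ}
    (ht : 0 ≤ t) {x : ℝ → E} {p : E} (hx : HasDerivWithinAt x p (Ici t) t) :
    HasDerivWithinAt (fun s => φ s (x s)) (fderivWithin ℝ (fun p : ℝ × E => φ p.1 p.2)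
      (Ici 0 ×ˢ univ) (t, x t) (1, p)) (Ici t) t := by
  have h1 := (h.diff (t, x t) ⟨ht, mem_univ _⟩).hasFDerivWithinAt
  have h2 : HasDerivWithinAt (fun s : ℝ => (s, x s)) (1, p) (Ici t) t :=
    (hasDerivWithinAt_id t _).prodMk hx
  have h3 : MapsTo (fun s : ℝ => (s, x s)) (Ici t) (Ici 0 ×ˢ univ) :=
    fun s hs => ⟨ht.trans hs, mem_univ _⟩
  exact h1.comp_hasDerivWithinAt t h2 h3

lemma UniformlyTame.continuousOn_comp {φ : ℝ → E → F} (h : UniformlyTame φ) {s : Set ℝ}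
    (hs : s ⊆ Ici 0) {x : ℝ → E} (hx : ContinuousOn x s) :
    ContinuousOn (fun t => φ t (x t)) s :=
  h.diff.continuousOn.comp (continuousOn_id.prodMk hx) fun _ ht => ⟨hs ht, mem_univ _⟩

lemma norm_sub_le_of_norm_fderivWithin_le {φ : ℝ → E → F} (h : UniformlyTame φ) {R C t : ℝ}
    (ht : 0 ≤ t) (hC : ∀ x : E, ‖x‖ ≤ R →
      ‖fderivWithin ℝ (fun p : ℝ × E => φ p.1 p.2) (Ici 0 ×ˢ univ) (t, x)‖ ≤ C)
    {x y : E} (hx : ‖x‖ ≤ R) (hy : ‖y‖ ≤ R) : ‖φ t x - φ t y‖ ≤ C * ‖x - y‖ := by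
  refine (convex_closedBall (0 : E) R).norm_image_sub_le_of_norm_hasFDerivWithin_le
    (fun z _ => (hasFDerivAt_of_differentiableOn h.diff ht z).hasFDerivWithinAt) (fun z hz => ?_)
    (by simpa using hy) (by simpa using hx)
  have h0 := hC z (by simpa using hz)
  refine (ContinuousLinearMap.opNorm_comp_le _ _).trans ?_
  have := mul_le_mul h0 (ContinuousLinearMap.norm_inr_le_one ℝ ℝ E) (norm_nonneg _)
    ((norm_nonneg _).trans h0)
  linarith

/-- One bound for the values and total derivatives of finitely many tame functions. -/
lemma exists_uniform_bound {ι : Type*} [Fintype ι] {φ : ι → ℝ → E → F}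
    (h : ∀ i, UniformlyTame (φ i)) (R : ℝ) : ∃ C : ℝ, 0 ≤ C ∧ ∀ i, ∀ t ≥ 0, ∀ x : E, ‖x‖ ≤ R →
      ‖φ i t x‖ ≤ C ∧
      ‖fderivWithin ℝ (fun p : ℝ × E => φ i p.1 p.2) (Ici 0 ×ˢ univ) (t, x)‖ ≤ C := by
  choose C hC using fun i => (h i).bound R
  refine ⟨∑ i, |C i|, Finset.sum_nonneg fun i _ => abs_nonneg _, fun i t ht x hx => ?_⟩
  have h1 : C i ≤ ∑ i, |C i| := (le_abs_self _).trans
    (Finset.single_le_sum (f := fun i => |C i|) (fun i _ => abs_nonneg _) (Finset.mem_univ i))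
  exact ⟨(hC i t ht x hx).1.trans h1, (hC i t ht x hx).2.trans h1⟩

/-- A continuous function that cannot reach the level `D` before leaving `(-∞, D)` never does. -/
lemma lt_of_forall_Ico_lt {d : ℝ → ℝ} {a b D : ℝ} (hd : ContinuousOn d (Icc a b))
    (h : ∀ s ∈ Icc a b, (∀ t ∈ Ico a s, d t < D) → d s < D) : ∀ t ∈ Icc a b, d t < D := by
  by_contra! hcon
  obtain ⟨t₁, ht₁, hD⟩ := hcon
  have hclosed : IsClosed (Icc a b ∩ d ⁻¹' Ici D) :=
    hd.preimage_isClosed_of_isClosed isClosed_Icc isClosed_Ici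
  have hbdd : BddBelow (Icc a b ∩ d ⁻¹' Ici D) := ⟨a, fun t ht => ht.1.1⟩
  have hmem := hclosed.csInf_mem ⟨t₁, ht₁, hD⟩ hbdd
  refine absurd (h _ hmem.1 fun t ht => ?_) (not_lt.2 hmem.2)
  by_contra! hDt
  exact absurd (csInf_le hbdd ⟨⟨ht.1, ht.2.le.trans hmem.1.2⟩, hDt⟩) (not_le.2 ht.2)

lemma gronwallBound_mul (c δ K ε s : ℝ) :
    gronwallBound (c * δ) K (c * ε) s = c * gronwallBound δ K ε s := by
  rcases eq_or_ne K 0 with rfl | hK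
  · simp only [gronwallBound_K0]
    ring
  · simp only [gronwallBound_of_K_ne_0 hK]
    ring

/-- Grönwall comparison of a curve `x` with a trajectory `y` of `ẏ = G(t, y)`, when a curve `z`
that is `η K₂`-close to `x` satisfies `ż = G(t, x) + O(η)`. -/
lemma norm_sub_le_of_near_identity {G : ℝ → E → E} {x y z : ℝ → E} {r : ℝ → E}
    {a s T η Λ K₁ K₂ : ℝ} (hη : 0 ≤ η) (hΛ : 0 ≤ Λ) (hK₁ : 0 ≤ K₁) (hK₂ : 0 ≤ K₂) (has : a ≤ s)
    (hsT : s ≤ a + T)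
    (hz : ContinuousOn z (Icc a s)) (hy : ContinuousOn y (Icc a s))
    (hz' : ∀ t ∈ Ico a s, HasDerivWithinAt z (G t (x t) + r t) (Ici t) t)
    (hy' : ∀ t ∈ Ico a s, HasDerivWithinAt y (G t (y t)) (Ici t) t) (hxy : x a = y a)
    (hzx : ∀ t ∈ Icc a s, ‖z t - x t‖ ≤ η * K₂) (hr : ∀ t ∈ Ico a s, ‖r t‖ ≤ η * K₁)
    (hG : ∀ t ∈ Ico a s, ‖G t (x t) - G t (y t)‖ ≤ Λ * ‖x t - y t‖) :
    ‖x s - y s‖ ≤ η * (gronwallBound K₂ Λ (Λ * K₂ + K₁) T + K₂) := by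
  have tri : ∀ t ∈ Icc a s, ‖x t - y t‖ ≤ ‖z t - y t‖ + η * K₂ := by
    intro t ht
    have e : x t - y t = (z t - y t) - (z t - x t) := by abel
    rw [e]
    exact (norm_sub_le _ _).trans (by linarith [hzx t ht])
  have hgr := norm_le_gronwallBound_of_norm_deriv_right_le (f := fun t => z t - y t)
    (f' := fun t => G t (x t) + r t - G t (y t)) (δ := η * K₂) (K := Λ)
    (ε := η * (Λ * K₂ + K₁)) (hz.sub hy) (fun t ht => (hz' t ht).sub (hy' t ht))
    (by rw [← hxy]; exact hzx a ⟨le_rfl, has⟩)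
    (fun t ht => by
      have h1 := hG t ht
      have h2 := tri t ⟨ht.1, ht.2.le⟩
      have h3 := hr t ht
      have e : G t (x t) + r t - G t (y t) = (G t (x t) - G t (y t)) + r t := by abel
      rw [e]
      refine (norm_add_le _ _).trans ?_
      have h4 := mul_le_mul_of_nonneg_left h2 hΛ
      linarith) s ⟨has, le_rfl⟩
  rw [gronwallBound_mul] at hgr
  have hmono : gronwallBound K₂ Λ (Λ * K₂ + K₁) (s - a) ≤ gronwallBound K₂ Λ (Λ * K₂ + K₁) T :=
    gronwallBound_mono hK₂ (by positivity) hΛ (by linarith)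
  have := mul_le_mul_of_nonneg_left hmono hη
  have := tri s ⟨has, le_rfl⟩
  linarith

end Averaging

/-! ### Lie bracket averaging -/

section AveragingTheorem

variable {E : Type*} [NormedAddCommGroup E] [NormedSpace ℝ E] {ι : Type*} [Fintype ι]

/-- The derivative `Dₓf(t, x) g(t, x)` of a time-dependent vector field `f` in the direction of
another one. -/
def dirDeriv (f g : ℝ → E → E) (t : ℝ) (x : E) : E := fderiv ℝ (f t) x (g t x)

/-- The near-identity change of variables
`x - σ⁻¹ ∑ᵢ Vᵢ(σ²t) fᵢ(t, x) + σ⁻² ∑ᵢⱼ Wᵢⱼ(σ²t) Dfᵢ fⱼ(t, x)`, with `σ = √ω`, that removes the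
oscillating terms of order `σ` and `1`. -/
def nearIdentity (V : ι → ℝ → ℝ) (W : ι → ι → ℝ → ℝ) (f : ι → ℝ → E → E) (σ t : ℝ) (x : E) : E :=
  x - σ⁻¹ • ∑ i, V i (σ ^ 2 * t) • f i t x +
    σ⁻¹ ^ 2 • ∑ i, ∑ j, W i j (σ ^ 2 * t) • dirDeriv (f i) (f j) t x

lemma abs_le_sum_sum_abs (m : ι → ι → ℝ) (i j : ι) : |m i j| ≤ ∑ i, ∑ j, |m i j| :=
  (Finset.single_le_sum (f := fun j => |m i j|) (fun _ _ => abs_nonneg _)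
    (Finset.mem_univ j)).trans
  (Finset.single_le_sum (f := fun i => ∑ j, |m i j|)
    (fun _ _ => Finset.sum_nonneg fun _ _ => abs_nonneg _) (Finset.mem_univ i))

lemma norm_sum_smul_le {c : ι → ℝ} {u : ι → E} {B C : ℝ} (hB : 0 ≤ B) (hc : ∀ i, |c i| ≤ B)
    (hu : ∀ i, ‖u i‖ ≤ C) : ‖∑ i, c i • u i‖ ≤ Fintype.card ι * (B * C) := by
  refine (norm_sum_le_of_le (f := fun i => c i • u i) _ (fun i _ => ?_)).trans_eq
    (b := ∑ _i : ι, B * C) (by simp)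
  rw [norm_smul]
  exact mul_le_mul (hc i) (hu i) (norm_nonneg _) hB

lemma norm_sum_sum_smul_le {c : ι → ι → ℝ} {u : ι → ι → E} {B C : ℝ} (hB : 0 ≤ B)
    (hc : ∀ i j, |c i j| ≤ B) (hu : ∀ i j, ‖u i j‖ ≤ C) :
    ‖∑ i, ∑ j, c i j • u i j‖ ≤ Fintype.card ι ^ 2 * (B * C) := by
  refine (norm_sum_le_of_le (f := fun i => ∑ j, c i j • u i j) _
    (fun i _ => norm_sum_smul_le hB (hc i) (hu i))).trans_eq
    (b := ∑ _i : ι, Fintype.card ι * (B * C)) ?_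
  simp only [Finset.sum_const, Finset.card_univ, nsmul_eq_mul]
  ring

lemma norm_nearIdentity_sub_le {V : ι → ℝ → ℝ} {W : ι → ι → ℝ → ℝ} {f : ι → ℝ → E → E}
    {σ t B C : ℝ} {x : E} (hσ : 1 ≤ σ) (hB : 0 ≤ B) (hV : ∀ i θ, |V i θ| ≤ B)
    (hW : ∀ i j θ, |W i j θ| ≤ B) (hf : ∀ i, ‖f i t x‖ ≤ C)
    (hg : ∀ i j, ‖dirDeriv (f i) (f j) t x‖ ≤ C) :
    ‖nearIdentity V W f σ t x - x‖ ≤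
      σ⁻¹ * (Fintype.card ι * (B * C) + Fintype.card ι ^ 2 * (B * C)) := by
  have h1 := norm_sum_smul_le hB (fun i => hV i (σ ^ 2 * t)) hf
  have h2 := norm_sum_sum_smul_le hB (fun i j => hW i j (σ ^ 2 * t)) hg
  have hη : 0 ≤ σ⁻¹ := by positivity
  have hη1 : σ⁻¹ ≤ 1 := inv_le_one_of_one_le₀ hσ
  have e : ∀ u w : E, x - u + w - x = w - u := fun u w => by abel
  rw [nearIdentity, e]
  refine (norm_sub_le _ _).trans ?_
  rw [norm_smul, norm_smul, norm_pow, Real.norm_of_nonneg hη]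
  have h3 := mul_le_mul_of_nonneg_left h1 hη
  have h4 : σ⁻¹ ^ 2 * ‖∑ i, ∑ j, W i j (σ ^ 2 * t) • dirDeriv (f i) (f j) t x‖ ≤
      σ⁻¹ * (Fintype.card ι ^ 2 * (B * C)) :=
    mul_le_mul (by nlinarith) h2 (norm_nonneg _) hη
  linarith

/-- Along a trajectory, the transformed variable satisfies the averaged equation up to `O(σ⁻¹)`. -/
lemma exists_hasDerivWithinAt_nearIdentity {v V : ι → ℝ → ℝ} {W : ι → ι → ℝ → ℝ} {m : ι → ι → ℝ}
    {f : ι → ℝ → E → E} {σ t B C : ℝ} {x : ℝ → E} (ht : 0 ≤ t) (hσ : 1 ≤ σ) (hB : 0 ≤ B)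
    (hv : ∀ i θ, |v i θ| ≤ B) (hV : ∀ i θ, |V i θ| ≤ B) (hW : ∀ i j θ, |W i j θ| ≤ B)
    (hVd : ∀ i θ, HasDerivAt (V i) (v i θ) θ)
    (hWd : ∀ i j θ, HasDerivAt (W i j) (V i θ * v j θ - m i j) θ)
    (hf : ∀ i, UniformlyTame (f i)) (hg : ∀ i j, UniformlyTame (dirDeriv (f i) (f j)))
    (hC : 0 ≤ C) (hfC : ∀ i, ‖f i t (x t)‖ ≤ C)
    (hfC' : ∀ i, ‖fderivWithin ℝ (fun p : ℝ × E => f i p.1 p.2) (Ici 0 ×ˢ univ) (t, x t)‖ ≤ C)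
    (hgC' : ∀ i j, ‖fderivWithin ℝ (fun p : ℝ × E => dirDeriv (f i) (f j) p.1 p.2)
      (Ici 0 ×ˢ univ) (t, x t)‖ ≤ C)
    (hx : HasDerivWithinAt x (σ • ∑ i, v i (σ ^ 2 * t) • f i t (x t)) (Ici t) t) :
    ∃ r : E, ‖r‖ ≤ σ⁻¹ * (Fintype.card ι * (B * C) + Fintype.card ι ^ 2 *
        (B * (C * (1 + Fintype.card ι * (B * C))))) ∧
      HasDerivWithinAt (fun s => nearIdentity V W f σ s (x s))
        (-(∑ i, ∑ j, m i j • dirDeriv (f i) (f j) t (x t)) + r) (Ici t) t := by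
  have hσ0 : 0 < σ := by linarith
  have hη : 0 ≤ σ⁻¹ := by positivity
  have hη1 : σ⁻¹ ≤ 1 := inv_le_one_of_one_le₀ hσ
  have hθ : HasDerivWithinAt (fun s : ℝ => σ ^ 2 * s) (σ ^ 2) (Ici t) t := by
    simpa using (hasDerivWithinAt_id t (Ici t)).const_mul (σ ^ 2)
  set θ := σ ^ 2 * t
  set p := σ • ∑ i, v i θ • f i t (x t) with hp
  set A : ι → ℝ × E →L[ℝ] E := fun i =>
    fderivWithin ℝ (fun p : ℝ × E => f i p.1 p.2) (Ici 0 ×ˢ univ) (t, x t)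
  set A' : ι → ι → ℝ × E →L[ℝ] E := fun i j =>
    fderivWithin ℝ (fun p : ℝ × E => dirDeriv (f i) (f j) p.1 p.2) (Ici 0 ×ˢ univ) (t, x t)
  have hdV : ∀ i, HasDerivWithinAt (fun s => V i (σ ^ 2 * s)) (v i θ * σ ^ 2) (Ici t) t :=
    fun i => (hVd i θ).comp_hasDerivWithinAt t hθ
  have hdW : ∀ i j, HasDerivWithinAt (fun s => W i j (σ ^ 2 * s))
      ((V i θ * v j θ - m i j) * σ ^ 2) (Ici t) t :=
    fun i j => (hWd i j θ).comp_hasDerivWithinAt t hθ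
  -- `d/dt fᵢ(t, x(t)) = ∂ₜfᵢ + σ ∑ⱼ vⱼ Dfᵢ fⱼ`; the second term is not small
  have hAp : ∀ i, A i (1, p) = A i (1, 0) + σ • ∑ j, v j θ • dirDeriv (f i) (f j) t (x t) := by
    intro i
    have e1 : ((1 : ℝ), p) = (1, 0) + ContinuousLinearMap.inr ℝ ℝ E p := by simp
    have e2 : fderiv ℝ (f i t) (x t) = (A i).comp (ContinuousLinearMap.inr ℝ ℝ E) :=
      (hasFDerivAt_of_differentiableOn (hf i).diff ht (x t)).fderiv
    rw [e1, map_add, ← ContinuousLinearMap.comp_apply, ← e2, hp, map_smul, map_sum]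
    simp only [map_smul, dirDeriv]
  have hpn : ‖p‖ ≤ σ * (Fintype.card ι * (B * C)) := by
    rw [hp, norm_smul, Real.norm_of_nonneg hσ0.le]
    exact mul_le_mul_of_nonneg_left (norm_sum_smul_le hB (fun i => hv i θ) hfC) hσ0.le
  refine ⟨σ⁻¹ ^ 2 • ∑ i, ∑ j, W i j θ • A' i j (1, p) - σ⁻¹ • ∑ i, V i θ • A i (1, 0), ?_, ?_⟩
  · have h1 : ‖∑ i, V i θ • A i (1, 0)‖ ≤ Fintype.card ι * (B * C) := by
      refine norm_sum_smul_le hB (fun i => hV i θ) fun i => ?_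
      refine ((A i).le_of_opNorm_le (hfC' i) _).trans ?_
      simp [Prod.norm_def]
    have hn : 0 ≤ (Fintype.card ι : ℝ) * (B * C) := by positivity
    have h2 : ‖∑ i, ∑ j, W i j θ • A' i j (1, p)‖ ≤
        Fintype.card ι ^ 2 * (B * (C * (σ * (1 + Fintype.card ι * (B * C))))) := by
      refine norm_sum_sum_smul_le hB (fun i j => hW i j θ) fun i j => ?_
      refine ((A' i j).le_of_opNorm_le (hgC' i j) _).trans ?_
      refine mul_le_mul_of_nonneg_left ?_ hC
      rw [Prod.norm_def]
      refine max_le ?_ ?_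
      · simp only [norm_one]
        nlinarith [mul_nonneg hσ0.le hn]
      · exact hpn.trans (by linarith)
    refine (norm_sub_le _ _).trans ?_
    rw [norm_smul, norm_smul, norm_pow, Real.norm_of_nonneg hη]
    have h3 := mul_le_mul_of_nonneg_left h1 hη
    have h4 := mul_le_mul_of_nonneg_left h2 (sq_nonneg σ⁻¹)
    have e : σ⁻¹ ^ 2 * (Fintype.card ι ^ 2 * (B * (C * (σ * (1 + Fintype.card ι * (B * C)))))) =
        σ⁻¹ * (Fintype.card ι ^ 2 * (B * (C * (1 + Fintype.card ι * (B * C))))) := by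
      field_simp
    linarith
  · have hd1 : HasDerivWithinAt (fun s => ∑ i, V i (σ ^ 2 * s) • f i s (x s))
        (∑ i, (V i θ • A i (1, p) + (v i θ * σ ^ 2) • f i t (x t))) (Ici t) t :=
      HasDerivWithinAt.fun_sum fun i _ => (hdV i).smul ((hf i).hasDerivWithinAt_comp ht hx)
    have hd2 : HasDerivWithinAt
        (fun s => ∑ i, ∑ j, W i j (σ ^ 2 * s) • dirDeriv (f i) (f j) s (x s))
        (∑ i, ∑ j, (W i j θ • A' i j (1, p) +
          ((V i θ * v j θ - m i j) * σ ^ 2) • dirDeriv (f i) (f j) t (x t))) (Ici t) t :=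
      HasDerivWithinAt.fun_sum fun i _ => HasDerivWithinAt.fun_sum fun j _ =>
        (hdW i j).smul ((hg i j).hasDerivWithinAt_comp ht hx)
    have hd := (hx.sub (hd1.const_smul σ⁻¹)).add (hd2.const_smul (σ⁻¹ ^ 2))
    refine hd.congr_deriv ?_
    have hp' : p = ∑ i, (σ * v i θ) • f i t (x t) := by
      rw [hp, Finset.smul_sum]
      simp only [smul_smul]
    obtain ⟨q, hq⟩ : ∃ q : ι → ι → E, ∀ i j, A' i j (1, p) = q i j := ⟨_, fun _ _ => rfl⟩
    simp only [hAp, hq]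
    rw [hp']
    simp only [smul_add, smul_sub, Finset.sum_add_distrib, Finset.smul_sum, smul_smul, sub_mul,
      sub_smul, Finset.sum_sub_distrib]
    -- the terms of order `σ` cancel, and those of order `1` leave only the means
    have e1 : ∀ i, σ⁻¹ * (v i θ * σ ^ 2) = σ * v i θ := fun i => by field_simp
    have e2 : ∀ i j, σ⁻¹ * (V i θ * (σ * v j θ)) = V i θ * v j θ := fun i j => by field_simp
    have e3 : ∀ i j, σ⁻¹ ^ 2 * (V i θ * v j θ * σ ^ 2) = V i θ * v j θ := fun i j => by field_simp
    have e4 : ∀ i j, σ⁻¹ ^ 2 * (m i j * σ ^ 2) = m i j := fun i j => by field_simp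
    simp only [e1, e2, e3, e4]
    abel

/-- **Lie bracket averaging.** For `ẋ = √ω ∑ᵢ vᵢ(ωt) fᵢ(t, x)` with inputs `vᵢ` that have bounded
primitives `Vᵢ`, such that the products `Vᵢ vⱼ` have means `mᵢⱼ` and their fluctuations have
bounded primitives `Wᵢⱼ`, the limit system is `ẋ = -∑ᵢⱼ mᵢⱼ Dfᵢ fⱼ`. -/
theorem approximates_of_bounded_primitives {v V : ι → ℝ → ℝ} {W : ι → ι → ℝ → ℝ} {m : ι → ι → ℝ}
    {f : ι → ℝ → E → E} {B : ℝ} {X : ℝ → ℝ → E → E} {G : ℝ → E → E} (hB : 0 ≤ B)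
    (hv : ∀ i θ, |v i θ| ≤ B) (hV : ∀ i θ, |V i θ| ≤ B) (hW : ∀ i j θ, |W i j θ| ≤ B)
    (hVd : ∀ i θ, HasDerivAt (V i) (v i θ) θ)
    (hWd : ∀ i j θ, HasDerivAt (W i j) (V i θ * v j θ - m i j) θ)
    (hf : ∀ i, UniformlyTame (f i)) (hg : ∀ i j, UniformlyTame (dirDeriv (f i) (f j)))
    (hX : ∀ ω > 0, ∀ t ≥ 0, ∀ x, X ω t x = √ω • ∑ i, v i (ω * t) • f i t x)
    (hG : ∀ t ≥ 0, ∀ x, G t x = -∑ i, ∑ j, m i j • dirDeriv (f i) (f j) t x) :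
    Approximates X G := by
  intro R T D hD
  obtain ⟨C₁, hC₁, hfC⟩ := exists_uniform_bound hf (R + 1)
  obtain ⟨C₂, hC₂, hgC⟩ := exists_uniform_bound
    (φ := fun q : ι × ι => dirDeriv (f q.1) (f q.2)) (fun q => hg q.1 q.2) (R + 1)
  set C := max C₁ C₂
  have hC : 0 ≤ C := le_max_of_le_left hC₁
  obtain ⟨M, hM0, hM⟩ : ∃ M : ℝ, 0 ≤ M ∧ ∀ i j, |m i j| ≤ M :=
    ⟨∑ i, ∑ j, |m i j|, by positivity, abs_le_sum_sum_abs m⟩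
  set Λ := (Fintype.card ι : ℝ) ^ 2 * (M * C) with hΛ
  set K₁ := Fintype.card ι * (B * C) + Fintype.card ι ^ 2 *
    (B * (C * (1 + Fintype.card ι * (B * C))))
  set K₂ := Fintype.card ι * (B * C) + (Fintype.card ι : ℝ) ^ 2 * (B * C)
  set Q := gronwallBound K₂ Λ (Λ * K₂ + K₁) T + K₂
  -- a distance of at most `1` from the averaged trajectory keeps `x` in the ball of radius `R + 1`
  set D' := min D 1
  have hD0 : 0 < D' := lt_min hD one_pos
  -- `√ω > Q / D'` makes the error `Q / √ω` of the comparison less than `D'`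
  refine ⟨1 + (Q / D') ^ 2, by positivity, fun ω hω t₀ ht₀ x₀ y x hy hyR hx => ?_⟩
  have hω0 : 0 < ω := lt_of_le_of_lt (by positivity) hω
  set σ := √ω
  have hσ2 : σ ^ 2 = ω := Real.sq_sqrt hω0.le
  have hσ1 : 1 ≤ σ := Real.one_le_sqrt.2 (by nlinarith [sq_nonneg (Q / D')])
  have hσ0 : 0 < σ := by linarith
  have hQσ : σ⁻¹ * Q < D' := by
    have h1 : Q / D' < σ := Real.lt_sqrt_of_sq_lt (by linarith)
    rw [div_lt_iff₀ hD0] at h1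
    rw [inv_mul_lt_iff₀ hσ0]
    exact h1
  have hsub : ∀ s, Icc t₀ s ⊆ Ici t₀ := fun s => Icc_subset_Ici_self
  have hyc : ContinuousOn y (Ici t₀) := fun t ht => (hy.2 t ht).continuousWithinAt
  have hD1 : ∀ t ∈ Icc t₀ (t₀ + T), dist (x t) (y t) < D' := by
    refine lt_of_forall_Ico_lt
      (continuous_dist.comp_continuousOn ((hx.cont.mono (hsub _)).prodMk (hyc.mono (hsub _))))
      fun s hs hlt => ?_
    rcases eq_or_lt_of_le hs.1 with rfl | hts
    · rw [hx.init, hy.1, dist_self]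
      exact hD0
    have hyn : ∀ t ∈ Icc t₀ s, ‖y t‖ ≤ R := fun t ht => hyR t ⟨ht.1, ht.2.trans hs.2⟩
    have hxn : ∀ t ∈ Ico t₀ s, ‖x t‖ < R + 1 := by
      intro t ht
      have h1 := (hlt t ht).trans_le (min_le_right _ _)
      rw [dist_eq_norm] at h1
      linarith [hyn t ⟨ht.1, ht.2.le⟩, norm_le_norm_add_norm_sub' (x t) (y t)]
    have hxn' : ∀ t ∈ Icc t₀ s, ‖x t‖ ≤ R + 1 := by
      have hcl : closure (Ico t₀ s) = Icc t₀ s := closure_Ico hts.ne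
      intro t ht
      refine le_on_closure (f := fun t => ‖x t‖) (g := fun _ => R + 1) (s := Ico t₀ s)
        (fun t ht => (hxn t ht).le) ?_ continuousOn_const (hcl ▸ ht)
      rw [hcl]
      exact (hx.cont.mono (hsub s)).norm
    have hfB : ∀ i, ∀ t ∈ Icc t₀ s, ‖f i t (x t)‖ ≤ C := fun i t ht =>
      (hfC i t (ht₀.trans ht.1) _ (hxn' t ht)).1.trans (le_max_left _ _)
    have hfB' : ∀ i, ∀ t ∈ Icc t₀ s, ‖fderivWithin ℝ (fun p : ℝ × E => f i p.1 p.2)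
        (Ici 0 ×ˢ univ) (t, x t)‖ ≤ C := fun i t ht =>
      (hfC i t (ht₀.trans ht.1) _ (hxn' t ht)).2.trans (le_max_left _ _)
    have hgB : ∀ i j, ∀ t ∈ Icc t₀ s, ‖dirDeriv (f i) (f j) t (x t)‖ ≤ C := fun i j t ht =>
      (hgC (i, j) t (ht₀.trans ht.1) _ (hxn' t ht)).1.trans (le_max_right _ _)
    have hgB' : ∀ i j, ∀ t ≥ 0, ∀ z : E, ‖z‖ ≤ R + 1 →
        ‖fderivWithin ℝ (fun p : ℝ × E => dirDeriv (f i) (f j) p.1 p.2)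
          (Ici 0 ×ˢ univ) (t, z)‖ ≤ C := fun i j t ht z hz =>
      (hgC (i, j) t ht z hz).2.trans (le_max_right _ _)
    have hder : ∀ t ∈ Ico t₀ s, ∃ r : E, ‖r‖ ≤ σ⁻¹ * K₁ ∧
        HasDerivWithinAt (fun s => nearIdentity V W f σ s (x s)) (G t (x t) + r) (Ici t) t := by
      intro t ht
      have ht0 : 0 ≤ t := ht₀.trans ht.1
      have hxd := (hx.deriv t ht.1 (by simpa using hxn t ht)).mono (Ici_subset_Ici.2 ht.1)
      rw [hX ω hω0 t ht0, ← hσ2, Real.sqrt_sq hσ0.le] at hxd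
      rw [hG t ht0]
      have htI : t ∈ Icc t₀ s := ⟨ht.1, ht.2.le⟩
      exact exists_hasDerivWithinAt_nearIdentity ht0 hσ1 hB hv hV hW hVd hWd hf hg hC
        (fun i => hfB i t htI) (fun i => hfB' i t htI)
        (fun i j => hgB' i j t ht0 _ (hxn t ht).le) hxd
    choose! r hr hzr using hder
    have hcont : ContinuousOn (fun s => nearIdentity V W f σ s (x s)) (Icc t₀ s) := by
      have hxs := hx.cont.mono (hsub s)
      have h0 : Icc t₀ s ⊆ Ici 0 := fun t ht => ht₀.trans ht.1
      have hVc : ∀ i, Continuous (V i) := fun i =>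
        continuous_iff_continuousAt.2 fun θ => (hVd i θ).continuousAt
      have hWc : ∀ i j, Continuous (W i j) := fun i j =>
        continuous_iff_continuousAt.2 fun θ => (hWd i j θ).continuousAt
      have hlin : Continuous fun t : ℝ => σ ^ 2 * t := by fun_prop
      refine (hxs.sub (ContinuousOn.const_smul ?_ _)).add (ContinuousOn.const_smul ?_ _)
      · exact continuousOn_finsetSum _ fun i _ =>
          (((hVc i).comp hlin).continuousOn).smul ((hf i).continuousOn_comp h0 hxs)
      · exact continuousOn_finsetSum _ fun i _ => continuousOn_finsetSum _ fun j _ =>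
          (((hWc i j).comp hlin).continuousOn).smul ((hg i j).continuousOn_comp h0 hxs)
    have hfin := norm_sub_le_of_near_identity (G := G) (x := x) (y := y) (r := r)
      (z := fun s => nearIdentity V W f σ s (x s)) (η := σ⁻¹) (Λ := Λ) (K₁ := K₁) (K₂ := K₂)
      (T := T) (by positivity) (by positivity) (by positivity) (by positivity) hs.1 hs.2 hcont
      (hyc.mono (hsub s)) hzr (fun t ht => (hy.2 t ht.1).mono (Ici_subset_Ici.2 ht.1))
      (hx.init.trans hy.1.symm)
      (fun t ht => norm_nearIdentity_sub_le hσ1 hB hV hW (fun i => hfB i t ht)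
        (fun i j => hgB i j t ht)) hr
      (fun t ht => by
        have ht0 : 0 ≤ t := ht₀.trans ht.1
        have e : G t (x t) - G t (y t) = -∑ i, ∑ j,
            m i j • (dirDeriv (f i) (f j) t (x t) - dirDeriv (f i) (f j) t (y t)) := by
          rw [hG t ht0, hG t ht0]
          simp only [smul_sub, Finset.sum_sub_distrib]
          abel
        rw [e, norm_neg]
        refine (norm_sum_sum_smul_le hM0 hM fun i j => norm_sub_le_of_norm_fderivWithin_le (hg i j)
          ht0 (hgB' i j t ht0) (hxn t ht).le
            ((hyn t ⟨ht.1, ht.2.le⟩).trans (by linarith))).trans_eq ?_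
        rw [hΛ]
        ring)
    rw [dist_eq_norm]
    exact hfin.trans_lt hQσ
  exact fun t ht => (hD1 t ht).trans_le (min_le_left _ _)

/-- Oscillating combinations of tame vector fields are locally solvable. -/
lemma locallySolvable_of_uniformlyTame [CompleteSpace E] {v : ι → ℝ → ℝ} {f : ι → ℝ → E → E}
    {B : ℝ} {X : ℝ → ℝ → E → E} (hB : 0 ≤ B) (hv : ∀ i θ, |v i θ| ≤ B)
    (hvc : ∀ i, Continuous (v i)) (hf : ∀ i, UniformlyTame (f i))
    (hX : ∀ ω > 0, ∀ t ≥ 0, ∀ x, X ω t x = √ω • ∑ i, v i (ω * t) • f i t x) :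
    LocallySolvable X := by
  intro ω hω ρ t₀ ht₀ x₀
  obtain ⟨C, hC, hfC⟩ := exists_uniform_bound hf (ρ + 1)
  have hK : 0 ≤ √ω * (Fintype.card ι * (B * C)) := by positivity
  refine exists_isSolutionOn_ball (K := ⟨_, hK⟩) (C := ⟨_, hK⟩) (fun t ht => ?_)
    (fun t ht x hx => ?_) (fun x => ?_) x₀
  · have ht0 : 0 ≤ t := ht₀.trans ht
    refine LipschitzOnWith.of_dist_le_mul fun x hx y hy => ?_
    rw [dist_eq_norm, dist_eq_norm, hX ω hω t ht0, hX ω hω t ht0, ← smul_sub,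
      ← Finset.sum_sub_distrib]
    simp only [← smul_sub]
    rw [norm_smul, Real.norm_of_nonneg (Real.sqrt_nonneg _)]
    refine (mul_le_mul_of_nonneg_left (norm_sum_smul_le hB (fun i => hv i (ω * t)) fun i =>
      norm_sub_le_of_norm_fderivWithin_le (hf i) ht0 (fun z hz => (hfC i t ht0 z hz).2)
        (by simpa using hx) (by simpa using hy)) (Real.sqrt_nonneg _)).trans_eq ?_
    change _ = √ω * (Fintype.card ι * (B * C)) * ‖x - y‖
    ring
  · have ht0 : 0 ≤ t := ht₀.trans ht
    rw [hX ω hω t ht0, norm_smul, Real.norm_of_nonneg (Real.sqrt_nonneg _)]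
    exact mul_le_mul_of_nonneg_left (norm_sum_smul_le hB (fun i => hv i (ω * t)) fun i =>
      (hfC i t ht0 x (by simpa using hx)).1) (Real.sqrt_nonneg _)
  · have h0 : Ici t₀ ⊆ Ici 0 := Ici_subset_Ici.2 ht₀
    refine ContinuousOn.congr (f := fun t => √ω • ∑ i, v i (ω * t) • f i t x) ?_
      (fun t ht => hX ω hω t (h0 ht) x)
    refine ContinuousOn.const_smul (continuousOn_finsetSum _ fun i _ => ?_) _
    exact (((hvc i).comp (by fun_prop : Continuous fun t : ℝ => ω * t)).continuousOn).smul
      ((hf i).continuousOn_comp h0 continuousOn_const)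

end AveragingTheorem

/-! ### Two-tone signals and the Wronskian identity -/

section Tones

/-- `u` has a primitive that is bounded on the whole line. -/
def HasBoundedPrimitive (u : ℝ → ℝ) : Prop :=
  ∃ (U : ℝ → ℝ) (B : ℝ), (∀ θ, HasDerivAt U (u θ) θ) ∧ ∀ θ, |U θ| ≤ B

lemma HasBoundedPrimitive.add {u w : ℝ → ℝ} (hu : HasBoundedPrimitive u)
    (hw : HasBoundedPrimitive w) : HasBoundedPrimitive (fun θ => u θ + w θ) := by
  obtain ⟨U, B, hU, hB⟩ := hu
  obtain ⟨W, C, hW, hC⟩ := hw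
  exact ⟨fun θ => U θ + W θ, B + C, fun θ => (hU θ).add (hW θ),
    fun θ => (abs_add_le _ _).trans (add_le_add (hB θ) (hC θ))⟩

lemma HasBoundedPrimitive.const_mul {u : ℝ → ℝ} (hu : HasBoundedPrimitive u) (c : ℝ) :
    HasBoundedPrimitive (fun θ => c * u θ) := by
  obtain ⟨U, B, hU, hB⟩ := hu
  refine ⟨fun θ => c * U θ, |c| * B, fun θ => (hU θ).const_mul c, fun θ => ?_⟩
  rw [abs_mul]
  exact mul_le_mul_of_nonneg_left (hB θ) (abs_nonneg c)

lemma hasDerivAt_sin_mul (c θ : ℝ) :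
    HasDerivAt (fun θ => Real.sin (c * θ)) (Real.cos (c * θ) * c) θ := by
  simpa using ((hasDerivAt_id θ).const_mul c).sin

lemma hasDerivAt_cos_mul (c θ : ℝ) :
    HasDerivAt (fun θ => Real.cos (c * θ)) (-Real.sin (c * θ) * c) θ := by
  simpa using ((hasDerivAt_id θ).const_mul c).cos

lemma hasBoundedPrimitive_cos {c : ℝ} (hc : c ≠ 0) :
    HasBoundedPrimitive (fun θ => Real.cos (c * θ)) := by
  refine ⟨fun θ => c⁻¹ * Real.sin (c * θ), |c⁻¹|, fun θ => ?_, fun θ => ?_⟩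
  · refine ((hasDerivAt_sin_mul c θ).const_mul c⁻¹).congr_deriv ?_
    field_simp
  · rw [abs_mul]
    exact mul_le_of_le_one_right (abs_nonneg _) (Real.abs_sin_le_one _)

lemma hasBoundedPrimitive_sin {c : ℝ} (hc : c ≠ 0) :
    HasBoundedPrimitive (fun θ => Real.sin (c * θ)) := by
  refine ⟨fun θ => -c⁻¹ * Real.cos (c * θ), |-c⁻¹|, fun θ => ?_, fun θ => ?_⟩
  · refine ((hasDerivAt_cos_mul c θ).const_mul (-c⁻¹)).congr_deriv ?_
    field_simp
  · rw [abs_mul]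
    exact mul_le_of_le_one_right (abs_nonneg _) (Real.abs_cos_le_one _)

/-- The signal `p cos(aθ) + q sin(aθ) + r cos(bθ) + s sin(bθ)`. -/
def twoTone (a b p q r s θ : ℝ) : ℝ :=
  p * Real.cos (a * θ) + q * Real.sin (a * θ) + r * Real.cos (b * θ) + s * Real.sin (b * θ)

lemma abs_twoTone_le (a b p q r s θ : ℝ) : |twoTone a b p q r s θ| ≤ |p| + |q| + |r| + |s| := by
  have key : ∀ u w : ℝ, |w| ≤ 1 → |u * w| ≤ |u| := fun u w hw => by
    rw [abs_mul]
    exact mul_le_of_le_one_right (abs_nonneg _) hw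
  unfold twoTone
  refine (abs_add_le _ _).trans (add_le_add ((abs_add_le _ _).trans (add_le_add
    ((abs_add_le _ _).trans (add_le_add ?_ ?_)) ?_)) ?_)
  exacts [key _ _ (Real.abs_cos_le_one _), key _ _ (Real.abs_sin_le_one _),
    key _ _ (Real.abs_cos_le_one _), key _ _ (Real.abs_sin_le_one _)]

/-- The mean-free primitive of a two-tone signal is a two-tone signal. -/
lemma hasDerivAt_twoTone_primitive {a b : ℝ} (ha : a ≠ 0) (hb : b ≠ 0) (p q r s θ : ℝ) :
    HasDerivAt (twoTone a b (-(q / a)) (p / a) (-(s / b)) (r / b)) (twoTone a b p q r s θ) θ := by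
  have h := ((((hasDerivAt_cos_mul a θ).const_mul (-(q / a))).add
    ((hasDerivAt_sin_mul a θ).const_mul (p / a))).add
    ((hasDerivAt_cos_mul b θ).const_mul (-(s / b)))).add
    ((hasDerivAt_sin_mul b θ).const_mul (r / b))
  refine h.congr_deriv ?_
  unfold twoTone
  field_simp
  ring

/-- The mean of the product of the primitive of one two-tone signal with another one. -/
def twoToneMean (a b p q r s p' q' r' s' : ℝ) : ℝ :=
  (p * q' - q * p') / (2 * a) + (r * s' - s * r') / (2 * b)

/-- The product of two two-tone signals, less its mean, is a sum of tones of the nonzero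
frequencies `2a`, `2b` and `a ± b`. -/
lemma hasBoundedPrimitive_twoTone_mul {a b : ℝ} (ha : 0 < a) (hb : 0 < b) (hab : a ≠ b)
    (p q r s p' q' r' s' : ℝ) : HasBoundedPrimitive (fun θ =>
      twoTone a b (-(q / a)) (p / a) (-(s / b)) (r / b) θ * twoTone a b p' q' r' s' θ -
        twoToneMean a b p q r s p' q' r' s') := by
  have h2a : 2 * a ≠ 0 := by positivity
  have h2b : 2 * b ≠ 0 := by positivity
  have hs : a + b ≠ 0 := by positivity
  have hd : a - b ≠ 0 := sub_ne_zero.2 hab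
  have key := ((((((((hasBoundedPrimitive_sin h2a).const_mul ((p / a * p' - q / a * q') / 2)).add
    ((hasBoundedPrimitive_cos h2a).const_mul ((-(p / a * q') - q / a * p') / 2))).add
    ((hasBoundedPrimitive_sin h2b).const_mul ((r / b * r' - s / b * s') / 2))).add
    ((hasBoundedPrimitive_cos h2b).const_mul ((-(r / b * s') - s / b * r') / 2))).add
    ((hasBoundedPrimitive_sin hs).const_mul
      ((p / a * r' - q / a * s' + r / b * p' - s / b * q') / 2))).add
    ((hasBoundedPrimitive_sin hd).const_mul
      ((p / a * r' + q / a * s' - r / b * p' - s / b * q') / 2))).add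
    ((hasBoundedPrimitive_cos hd).const_mul
      ((p / a * s' - q / a * r' + r / b * q' - s / b * p') / 2))).add
    ((hasBoundedPrimitive_cos hs).const_mul
      ((-(p / a * s') - q / a * r' - r / b * q' - s / b * p') / 2))
  convert key using 2 with θ
  have hm : twoToneMean a b p q r s p' q' r' s' =
      (p / a * q' - q / a * p') / 2 + (r / b * s' - s / b * r') / 2 := by
    unfold twoToneMean
    field_simp
  rw [hm, mul_assoc 2 a θ, mul_assoc 2 b θ, add_mul, sub_mul, Real.sin_two_mul, Real.cos_two_mul,
    Real.sin_two_mul, Real.cos_two_mul, Real.sin_add, Real.sin_sub, Real.cos_sub, Real.cos_add]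
  unfold twoTone
  linear_combination (p / a * q') * Real.sin_sq_add_cos_sq (a * θ) +
    (r / b * s') * Real.sin_sq_add_cos_sq (b * θ)

end Tones

section Wronskian

variable {E : Type*} [NormedAddCommGroup E] [NormedSpace ℝ E]

/-- The Wronskian identity `F₁ F₂' - F₂ F₁' = -1`, composed with a cost `j`. Off the zeros of
`F₁ ∘ j` it is the product rule; it passes to the closure by continuity, and in the interior of
the zero set `j` is locally constant, because the zeros of `F₁` are isolated. Neither `F₁` nor `F₂`
need be differentiable. -/
lemma IsSeekingPair.wronskian {F₁ F₂ : ℝ → ℝ} (hF : IsSeekingPair F₁ F₂) {j : E → ℝ}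
    (hj : ContDiff ℝ 1 j) (h₁ : ContDiff ℝ 1 (F₁ ∘ j)) (h₂ : ContDiff ℝ 1 (F₂ ∘ j)) (x : E) :
    F₁ (j x) • fderiv ℝ (F₂ ∘ j) x - F₂ (j x) • fderiv ℝ (F₁ ∘ j) x = -fderiv ℝ j x := by
  obtain ⟨Ψ, hΨ⟩ := hF.antideriv
  have hU : IsOpen {y | F₁ (j y) ≠ 0} := isOpen_ne_fun h₁.continuous continuous_const
  have hon : ∀ y ∈ {y | F₁ (j y) ≠ 0},
      F₁ (j y) • fderiv ℝ (F₂ ∘ j) y - F₂ (j y) • fderiv ℝ (F₁ ∘ j) y = -fderiv ℝ j y := by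
    intro y hy
    have hjd : HasFDerivAt j (fderiv ℝ j y) y := (hj.differentiable one_ne_zero y).hasFDerivAt
    have h1d : HasFDerivAt (F₁ ∘ j) (fderiv ℝ (F₁ ∘ j) y) y :=
      (h₁.differentiable one_ne_zero y).hasFDerivAt
    have hΨd : HasFDerivAt (fun z => Ψ (j z)) ((1 / F₁ (j y) ^ 2) • fderiv ℝ j y) y :=
      (hΨ _ hy).1.comp_hasFDerivAt y hjd
    have heq : (F₂ ∘ j) =ᶠ[𝓝 y] fun z => -((F₁ ∘ j) z * Ψ (j z)) := by
      filter_upwards [hU.mem_nhds hy] with z hz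
      exact (hΨ _ hz).2
    rw [((h1d.mul hΨd).fun_neg.congr_of_eventuallyEq heq).fderiv, (hΨ _ hy).2]
    have hy' : F₁ (j y) ≠ 0 := hy
    ext w
    simp only [sub_apply, smul_apply, neg_apply, add_apply, smul_eq_mul, Function.comp_apply]
    field_simp
    ring
  by_cases hx : x ∈ closure {y | F₁ (j y) ≠ 0}
  · have hc₁ : Continuous fun y =>
        F₁ (j y) • fderiv ℝ (F₂ ∘ j) y - F₂ (j y) • fderiv ℝ (F₁ ∘ j) y :=
      (h₁.continuous.smul (h₂.continuous_fderiv one_ne_zero)).sub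
        (h₂.continuous.smul (h₁.continuous_fderiv one_ne_zero))
    have hc₂ : Continuous fun y => -fderiv ℝ j y := (hj.continuous_fderiv one_ne_zero).neg
    exact (show EqOn _ _ _ from hon).closure hc₁ hc₂ hx
  · have hz : ∀ᶠ y in 𝓝 x, F₁ (j y) = 0 := by
      filter_upwards [isClosed_closure.isOpen_compl.mem_nhds hx] with y hy
      by_contra h
      exact hy (subset_closure h)
    have hiso := eventually_nhdsWithin_iff.1 (hF.isolated_zeros _ hz.self_of_nhds)
    have hconst : ∀ᶠ y in 𝓝 x, j y = j x := by
      filter_upwards [hz, hj.continuous.continuousAt.eventually hiso] with y h0 h1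
      by_contra h
      exact h1 h h0
    have hd : ∀ φ : ℝ → ℝ, fderiv ℝ (φ ∘ j) x = 0 := by
      intro φ
      have : (φ ∘ j) =ᶠ[𝓝 x] fun _ => φ (j x) := hconst.mono fun y hy => congrArg φ hy
      rw [this.fderiv_eq]
      simp
    have hd0 := hd id
    rw [Function.id_comp] at hd0
    rw [hd, hd, hd0]
    simp

end Wronskian

/-! ### Derivatives of the planar fields -/

section DirDeriv

variable {E : Type*} [NormedAddCommGroup E] [NormedSpace ℝ E]

lemma uniqueDiffOn_halfspace : UniqueDiffOn ℝ (Ici (0 : ℝ) ×ˢ (univ : Set E)) :=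
  (uniqueDiffOn_Ici 0).prod uniqueDiffOn_univ

/-- The state derivative of a `C²` time-dependent vector field is differentiable. -/
lemma differentiableOn_fderiv {f : ℝ → E → E}
    (hf : ContDiffOn ℝ 2 (fun p : ℝ × E => f p.1 p.2) (Ici 0 ×ˢ univ)) :
    DifferentiableOn ℝ (fun p : ℝ × E => fderiv ℝ (f p.1) p.2) (Ici 0 ×ˢ univ) := by
  have h1 : DifferentiableOn ℝ (fderivWithin ℝ (fun p : ℝ × E => f p.1 p.2) (Ici 0 ×ˢ univ))
      (Ici 0 ×ˢ univ) :=
    (hf.fderivWithin (m := 1) uniqueDiffOn_halfspace (by norm_num)).differentiableOn one_ne_zero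
  have h2 := h1.clm_comp (differentiableOn_const (ContinuousLinearMap.inr ℝ ℝ E))
  exact h2.congr fun p hp =>
    (hasFDerivAt_of_differentiableOn (hf.differentiableOn two_ne_zero) hp.1 p.2).fderiv

lemma differentiableOn_dirDeriv {f g : ℝ → E → E}
    (hf : ContDiffOn ℝ 2 (fun p : ℝ × E => f p.1 p.2) (Ici 0 ×ˢ univ))
    (hg : DifferentiableOn ℝ (fun p : ℝ × E => g p.1 p.2) (Ici 0 ×ˢ univ)) :
    DifferentiableOn ℝ (fun p : ℝ × E => dirDeriv f g p.1 p.2) (Ici 0 ×ˢ univ) :=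
  (differentiableOn_fderiv hf).clm_apply hg

/-- The time derivative of `Df g` is a combination of `∂ₜDf`, `g`, `Df` and `∂ₜg`. -/
lemma norm_derivWithin_dirDeriv_le {f g : ℝ → E → E}
    (hf : ContDiffOn ℝ 2 (fun p : ℝ × E => f p.1 p.2) (Ici 0 ×ˢ univ))
    (hg : DifferentiableOn ℝ (fun p : ℝ × E => g p.1 p.2) (Ici 0 ×ˢ univ)) {t C : ℝ} (ht : 0 ≤ t)
    {x : E} (h1 : ‖fderiv ℝ (f t) x‖ ≤ C)
    (h2 : ‖derivWithin (fun s => fderiv ℝ (f s) x) (Ici 0) t‖ ≤ C) (h3 : ‖g t x‖ ≤ C)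
    (h4 : ‖derivWithin (fun s => g s x) (Ici 0) t‖ ≤ C) :
    ‖derivWithin (fun s => dirDeriv f g s x) (Ici 0) t‖ ≤ 2 * (C * C) := by
  have hC : 0 ≤ C := (norm_nonneg _).trans h1
  have d1 : HasDerivWithinAt (fun s => fderiv ℝ (f s) x)
      (derivWithin (fun s => fderiv ℝ (f s) x) (Ici 0) t) (Ici 0) t :=
    (hasDerivWithinAt_of_differentiableOn (φ := fun s y => fderiv ℝ (f s) y)
      (differentiableOn_fderiv hf) ht x).differentiableWithinAt.hasDerivWithinAt
  have d2 := (hasDerivWithinAt_of_differentiableOn hg ht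
    x).differentiableWithinAt.hasDerivWithinAt
  have d := d1.clm_apply d2
  change ‖derivWithin (fun s => fderiv ℝ (f s) x (g s x)) (Ici 0) t‖ ≤ _
  rw [d.derivWithin (uniqueDiffOn_Ici 0 t ht)]
  refine (norm_add_le _ _).trans ?_
  have e1 := ContinuousLinearMap.le_of_opNorm_le _ h2 (g t x)
  have e2 := ContinuousLinearMap.le_of_opNorm_le _ h1 (derivWithin (fun s => g s x) (Ici 0) t)
  have e3 := mul_le_mul_of_nonneg_left h3 hC
  have e4 := mul_le_mul_of_nonneg_left h4 hC
  linarith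

end DirDeriv

section PlanarFields

/-- The `a`-th unit vector of the plane. -/
def unitVec (a : Fin 2) : Plane := EuclideanSpace.single a 1

lemma norm_unitVec (a : Fin 2) : ‖unitVec a‖ = 1 := by simp [unitVec]

variable {h : Fin 2 → ℝ → Plane → ℝ}

/-- The vector field `h_s(t, x) e_a`, for the pair `(s, a)`. -/
def axisField (h : Fin 2 → ℝ → Plane → ℝ) (i : Fin 2 × Fin 2) (t : ℝ) (x : Plane) : Plane :=
  h i.1 t x • unitVec i.2

lemma fderiv_axisField {i : Fin 2 × Fin 2} {t : ℝ} {x : Plane}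
    (hd : DifferentiableAt ℝ (h i.1 t) x) :
    fderiv ℝ (axisField h i t) x = (fderiv ℝ (h i.1 t) x).smulRight (unitVec i.2) :=
  (hd.hasFDerivAt.smul_const (unitVec i.2)).fderiv

lemma dirDeriv_axisField {i j : Fin 2 × Fin 2} {t : ℝ} {x : Plane}
    (hd : DifferentiableAt ℝ (h i.1 t) x) :
    dirDeriv (axisField h i) (axisField h j) t x =
      (h j.1 t x * fderiv ℝ (h i.1 t) x (unitVec j.2)) • unitVec i.2 := by
  rw [dirDeriv, fderiv_axisField hd]
  simp [axisField, smul_smul]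

/-- The bracket of `h_s e_0` and `h_s' e_1` has the coordinates `-h_s' ∂₁h_s` and `h_s ∂₀h_s'`. So a
bound on the derivative of the brackets bounds the derivative of every product `h_s' ∂ₐh_s`,
although no second derivative of a single `h_s` is assumed bounded. -/
lemma norm_fderiv_dirDeriv_axisField_le {t C : ℝ} {x : Plane}
    (hd : ∀ s y, DifferentiableAt ℝ (h s t) y)
    (hdd : ∀ i j, DifferentiableAt ℝ (dirDeriv (axisField h i) (axisField h j) t) x)
    (hC : ∀ s s', ‖fderiv ℝ (fun y => VectorField.lieBracket ℝ (axisField h (s, 0) t)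
      (axisField h (s', 1) t) y) x‖ ≤ C) (i j : Fin 2 × Fin 2) :
    ‖fderiv ℝ (dirDeriv (axisField h i) (axisField h j) t) x‖ ≤ C := by
  have hbr : ∀ s s', HasFDerivAt (fun y => VectorField.lieBracket ℝ (axisField h (s, 0) t)
      (axisField h (s', 1) t) y) (fderiv ℝ (fun y => VectorField.lieBracket ℝ (axisField h (s, 0) t)
      (axisField h (s', 1) t) y) x) x := fun s s' =>
    ((hdd (s', 1) (s, 0)).sub (hdd (s, 0) (s', 1))).hasFDerivAt
  have hbr_eq : ∀ s s' y,
      VectorField.lieBracket ℝ (axisField h (s, 0) t) (axisField h (s', 1) t) y =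
      (h s t y * fderiv ℝ (h s' t) y (unitVec 0)) • unitVec 1 -
        (h s' t y * fderiv ℝ (h s t) y (unitVec 1)) • unitVec 0 := fun s s' y => by
    have e1 := dirDeriv_axisField (h := h) (i := (s', 1)) (j := (s, 0)) (hd s' y)
    have e2 := dirDeriv_axisField (h := h) (i := (s, 0)) (j := (s', 1)) (hd s y)
    simp only at e1 e2
    rw [← e1, ← e2]
    rfl
  have hproj : ∀ (a : Fin 2) (A : Plane →L[ℝ] Plane),
      ‖(EuclideanSpace.proj a : Plane →L[ℝ] ℝ).comp A‖ ≤ ‖A‖ := fun a A =>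
    ContinuousLinearMap.opNorm_le_bound _ (norm_nonneg _) fun w =>
      (PiLp.norm_apply_le (A w) a).trans (A.le_opNorm w)
  have hq : ∀ (s s' a : Fin 2), ∃ A : Plane →L[ℝ] ℝ, ‖A‖ ≤ C ∧
      HasFDerivAt (fun y => h s' t y * fderiv ℝ (h s t) y (unitVec a)) A x := by
    intro s s' a
    rcases Fin.exists_fin_two.1 ⟨a, rfl⟩ with rfl | rfl
    -- `a` selects the coordinate of the bracket in which `h_s' ∂ₐh_s` appears
    · refine ⟨(EuclideanSpace.proj 1 : Plane →L[ℝ] ℝ).comp _, (hproj 1 _).trans (hC s' s), ?_⟩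
      refine ((EuclideanSpace.proj (𝕜 := ℝ) (1 : Fin 2)).hasFDerivAt.comp x
        (hbr s' s)).congr_of_eventuallyEq (Eventually.of_forall fun y => ?_)
      simp [hbr_eq, unitVec]
    · refine ⟨-(EuclideanSpace.proj 0 : Plane →L[ℝ] ℝ).comp _,
        (norm_neg _).trans_le ((hproj 0 _).trans (hC s s')), ?_⟩
      refine ((EuclideanSpace.proj (𝕜 := ℝ) (0 : Fin 2)).hasFDerivAt.comp x
        (hbr s s')).neg.congr_of_eventuallyEq (Eventually.of_forall fun y => ?_)
      simp [hbr_eq, unitVec]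
  obtain ⟨A, hA, hAd⟩ := hq i.1 j.1 j.2
  have heq : dirDeriv (axisField h i) (axisField h j) t =
      fun y => (h j.1 t y * fderiv ℝ (h i.1 t) y (unitVec j.2)) • unitVec i.2 :=
    funext fun y => dirDeriv_axisField (hd i.1 y)
  rw [heq, (hAd.smul_const (unitVec i.2)).fderiv, ContinuousLinearMap.norm_smulRight_apply,
    norm_unitVec, mul_one]
  exact hA

end PlanarFields

/-! ### The closed loop -/

section ClosedLoop

/-- The two measured outputs `F₁(J)` and `F₂(J)`. -/
def output (F₁ F₂ : ℝ → ℝ) (J : Plane → Plane → ℝ) (γ : ℝ → Plane) (s : Fin 2) (t : ℝ)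
    (x : Plane) : ℝ := ![F₁, F₂] s (J x (γ t))

/-- The position in `fields` of the field `F_s(J) e_a`. -/
def fieldIndex (i : Fin 2 × Fin 2) : Fin 5 := ![![1, 3], ![2, 4]] i.1 i.2

variable {F₁ F₂ : ℝ → ℝ} {J : Plane → Plane → ℝ} {γ : ℝ → Plane}

lemma fields_fieldIndex (i : Fin 2 × Fin 2) :
    fields F₁ F₂ J γ (fieldIndex i) = axisField (output F₁ F₂ J γ) i := by
  obtain ⟨s, a⟩ := i
  funext t x
  ext b
  fin_cases s <;> fin_cases a <;> fin_cases b <;>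
    simp [fields, fieldIndex, axisField, output, unitVec]

lemma fieldIndex_ne_zero (i : Fin 2 × Fin 2) : fieldIndex i ≠ 0 := by
  revert i
  decide

lemma fieldIndex_le (s s' : Fin 2) : fieldIndex (s, 0) ≤ fieldIndex (s', 1) := by
  revert s s'
  decide

lemma contDiffOn_axisField (hA1 : AssumptionA1 (fields F₁ F₂ J γ)) (i : Fin 2 × Fin 2) :
    ContDiffOn ℝ 2 (fun p : ℝ × Plane => axisField (output F₁ F₂ J γ) i p.1 p.2)
      (Ici 0 ×ˢ univ) := by
  have := hA1 (fieldIndex i)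
  rwa [fields_fieldIndex] at this

lemma differentiableAt_output (h₁ : ContDiff ℝ 1 (F₁ ∘ Function.uncurry J))
    (h₂ : ContDiff ℝ 1 (F₂ ∘ Function.uncurry J)) (s : Fin 2) (t : ℝ) (x : Plane) :
    DifferentiableAt ℝ (output F₁ F₂ J γ s t) x := by
  have hc : ContDiff ℝ 1 fun y : Plane => (y, γ t) := contDiff_prodMk_left (γ t)
  rcases Fin.exists_fin_two.1 ⟨s, rfl⟩ with rfl | rfl
  · exact (h₁.comp hc).differentiable one_ne_zero x
  · exact (h₂.comp hc).differentiable one_ne_zero x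

lemma uniformlyTame_axisField (hA1 : AssumptionA1 (fields F₁ F₂ J γ))
    (hA2 : AssumptionA2 (fields F₁ F₂ J γ)) (i : Fin 2 × Fin 2) :
    UniformlyTame (axisField (output F₁ F₂ J γ) i) := by
  have hdiff := (contDiffOn_axisField hA1 i).differentiableOn two_ne_zero
  refine ⟨hdiff, fun R => ?_⟩
  obtain ⟨C, hC⟩ := hA2 _ (isCompact_closedBall (0 : Plane) R)
  refine ⟨2 * C, fun t ht x hx => ?_⟩
  obtain ⟨h1, h2, h3⟩ := (hC t ht x (by simpa using hx)).1 (fieldIndex i)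
  rw [fields_fieldIndex] at h1 h2 h3
  have hC0 : 0 ≤ C := (norm_nonneg _).trans h1
  exact ⟨h1.trans (by linarith), norm_fderivWithin_le_of_partial hdiff ht hC0 h2 h3⟩

lemma uniformlyTame_dirDeriv_axisField (hA1 : AssumptionA1 (fields F₁ F₂ J γ))
    (hA2 : AssumptionA2 (fields F₁ F₂ J γ)) (h₁ : ContDiff ℝ 1 (F₁ ∘ Function.uncurry J))
    (h₂ : ContDiff ℝ 1 (F₂ ∘ Function.uncurry J)) (i j : Fin 2 × Fin 2) :
    UniformlyTame (dirDeriv (axisField (output F₁ F₂ J γ) i) (axisField (output F₁ F₂ J γ) j)) := by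
  have hf := contDiffOn_axisField (F₁ := F₁) (F₂ := F₂) (J := J) (γ := γ) hA1
  have hdiff : ∀ i j, DifferentiableOn ℝ (fun p : ℝ × Plane => dirDeriv
      (axisField (output F₁ F₂ J γ) i) (axisField (output F₁ F₂ J γ) j) p.1 p.2)
      (Ici 0 ×ˢ univ) := fun i j =>
    differentiableOn_dirDeriv (hf i) ((hf j).differentiableOn two_ne_zero)
  refine ⟨hdiff i j, fun R => ?_⟩
  obtain ⟨C, hC⟩ := hA2 _ (isCompact_closedBall (0 : Plane) R)
  refine ⟨2 * (2 * (C * C) + C), fun t ht x hx => ?_⟩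
  obtain ⟨h1, h2, h3⟩ := hC t ht x (by simpa using hx)
  have hi := h1 (fieldIndex i)
  have hj := h1 (fieldIndex j)
  have hi' := h2 (fieldIndex i) (fieldIndex_ne_zero i)
  have hb : ∀ s s', _ := fun s s' =>
    (h3 (fieldIndex (s, 0)) (fieldIndex (s', 1)) (fieldIndex_ne_zero _) (fieldIndex_le s s')).2
  simp only [fields_fieldIndex] at hi hj hi' hb
  have hC0 : 0 ≤ C := (norm_nonneg _).trans hi.1
  have hCC : 0 ≤ C * C := mul_nonneg hC0 hC0
  have ht' := norm_derivWithin_dirDeriv_le (hf i) ((hf j).differentiableOn two_ne_zero) ht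
    hi.2.2 hi' hj.1 hj.2.1
  have hx' := norm_fderiv_dirDeriv_axisField_le (differentiableAt_output h₁ h₂ · t)
    (fun i j => (hasFDerivAt_of_differentiableOn (hdiff i j) ht x).differentiableAt) hb i j
  refine ⟨?_, norm_fderivWithin_le_of_partial (hdiff i j) ht (by linarith) (ht'.trans (by linarith))
    (hx'.trans (by linarith))⟩
  have := (ContinuousLinearMap.le_of_opNorm_le _ hi.2.2
    (axisField (output F₁ F₂ J γ) j t x)).trans (mul_le_mul_of_nonneg_left hj.1 hC0)
  exact this.trans (by linarith)

/-- The Fourier coefficients of `2κ cos θ cos(θ/k)`, `2κ sin θ cos(θ/k)`, `2κ cos θ sin(θ/k)` and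
`2κ sin θ sin(θ/k)`, which are sums of tones of the frequencies `1 ± 1/k`. The index `(s, a)` stands
for the product of the `s`-th carrier (`cos θ`, `sin θ`) and the `a`-th steering signal (`cos(θ/k)`,
`sin(θ/k)`), and `n` runs through the four coefficients of `twoTone`. -/
def inputCoeff (κ : ℝ) (n : Fin 4) (i : Fin 2 × Fin 2) : ℝ :=
  ![![![κ, 0], ![0, -κ]], ![![0, κ], ![κ, 0]], ![![κ, 0], ![0, κ]], ![![0, -κ], ![κ, 0]]] n i.1 i.2

/-- The input that multiplies the field `F_s(J) e_a`, as a function of the phase `θ = ωt`. -/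
def input (k : ℕ) (κ : ℝ) (i : Fin 2 × Fin 2) : ℝ → ℝ :=
  twoTone (1 + 1 / k) (1 - 1 / k) (inputCoeff κ 0 i) (inputCoeff κ 1 i) (inputCoeff κ 2 i)
    (inputCoeff κ 3 i)

/-- The mean of the product of the primitive of the `i`-th and the `j`-th input. -/
def inputMean (k : ℕ) (κ : ℝ) (i j : Fin 2 × Fin 2) : ℝ :=
  twoToneMean (1 + 1 / k) (1 - 1 / k) (inputCoeff κ 0 i) (inputCoeff κ 1 i) (inputCoeff κ 2 i)
    (inputCoeff κ 3 i) (inputCoeff κ 0 j) (inputCoeff κ 1 j) (inputCoeff κ 2 j) (inputCoeff κ 3 j)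

lemma continuous_input (k : ℕ) (κ : ℝ) (i : Fin 2 × Fin 2) : Continuous (input k κ i) := by
  unfold input twoTone
  fun_prop

lemma closedLoop_eq_sum (k : ℕ) {ϑ ω : ℝ} (hω : 0 < ω) (t : ℝ) (x : Plane) :
    closedLoop k ϑ F₁ F₂ J γ ω t x =
      √ω • ∑ i, input k (√(ϑ * alpha k) / 2) i (ω * t) • axisField (output F₁ F₂ J γ) i t x := by
  have hs : √(ϑ * alpha k * ω) = √ω * √(ϑ * alpha k) := by
    rw [mul_comm, Real.sqrt_mul hω.le]
  have e1 : (1 + 1 / (k : ℝ)) * (ω * t) = ω * t + ω / k * t := by ring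
  have e2 : (1 - 1 / (k : ℝ)) * (ω * t) = ω * t - ω / k * t := by ring
  ext b
  fin_cases b <;>
    simp [closedLoop, unicycle, control, Fintype.sum_prod_type, input, twoTone, inputCoeff,
      axisField, output, unitVec, hs, -one_div, e1, e2, Real.cos_add, Real.cos_sub, Real.sin_add,
      Real.sin_sub] <;>
    ring

lemma gradient_apply (φ : Plane → ℝ) (x : Plane) (a : Fin 2) :
    (∇ φ x) a = fderiv ℝ φ x (unitVec a) := by
  rw [← inner_gradient_left, unitVec, EuclideanSpace.inner_single_right]
  simp

lemma inv_lt_one_of_one_lt_nat {k : ℕ} (hk : 1 < k) : 1 / (k : ℝ) < 1 := by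
  have h1 : (1 : ℝ) < k := by exact_mod_cast hk
  rw [div_lt_one (by linarith)]
  exact h1

/-- The brackets of the two fields along one axis give `-∇J` by the Wronskian identity, those of one
output along the two axes give the rotational part. -/
lemma lieSystem_eq_sum {k : ℕ} (hk : 1 < k) {ϑ : ℝ} (hϑ : 0 < ϑ) (hF : IsSeekingPair F₁ F₂)
    (hJ : ContDiff ℝ 2 (Function.uncurry J)) (h₁ : ContDiff ℝ 1 (F₁ ∘ Function.uncurry J))
    (h₂ : ContDiff ℝ 1 (F₂ ∘ Function.uncurry J)) (t : ℝ) (x : Plane) :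
    lieSystem k ϑ F₁ F₂ J γ t x = -∑ i, ∑ j, inputMean k (√(ϑ * alpha k) / 2) i j •
      dirDeriv (axisField (output F₁ F₂ J γ) i) (axisField (output F₁ F₂ J γ) j) t x := by
  have hk1 : (1 : ℝ) < k := by exact_mod_cast hk
  have hk0 : (k : ℝ) ≠ 0 := by linarith
  have hkinv := inv_lt_one_of_one_lt_nat hk
  have hkpos : 0 < 1 / (k : ℝ) := by positivity
  have hα : 0 ≤ alpha k := by
    unfold alpha
    have : 1 / (k : ℝ) ^ 2 ≤ 1 := by
      rw [← one_div_pow]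
      exact pow_le_one₀ hkpos.le hkinv.le
    linarith
  have hκ : (√(ϑ * alpha k) / 2) ^ 2 = ϑ * (1 - 1 / (k : ℝ) ^ 2) := by
    rw [div_pow, Real.sq_sqrt (mul_nonneg hϑ.le hα), alpha]
    ring
  set κ := √(ϑ * alpha k) / 2
  have ha : 1 + 1 / (k : ℝ) ≠ 0 := by positivity
  have hb : 1 - 1 / (k : ℝ) ≠ 0 := by linarith
  -- `κ² = ϑ (1 + 1/k) (1 - 1/k)`, so the contributions of the two tones to the means are
  -- `ϑ (1 ∓ 1/k) / 2`, with the sum `ϑ` and the difference `-ϑ / k`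
  have hplus : κ * κ / (2 * (1 + 1 / (k : ℝ))) = ϑ / 2 * (1 - 1 / k) := by
    rw [div_eq_iff (by positivity), ← pow_two, hκ]
    ring
  have hminus : κ * κ / (2 * (1 - 1 / (k : ℝ))) = ϑ / 2 * (1 + 1 / k) := by
    rw [div_eq_iff (by simpa using hb), ← pow_two, hκ]
    ring
  have hc : ContDiff ℝ 1 fun y : Plane => (y, γ t) := contDiff_prodMk_left (γ t)
  have hjc : ContDiff ℝ 1 fun y => J y (γ t) := (hJ.of_le one_le_two).comp hc
  have h1c : ContDiff ℝ 1 (F₁ ∘ fun y => J y (γ t)) := h₁.comp hc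
  have h2c : ContDiff ℝ 1 (F₂ ∘ fun y => J y (γ t)) := h₂.comp hc
  have hW := hF.wronskian hjc h1c h2c x
  have hD1 : HasFDerivAt (fun y => F₁ (J y (γ t))) (fderiv ℝ (fun y => F₁ (J y (γ t))) x) x :=
    (h1c.differentiable one_ne_zero x).hasFDerivAt
  have hD2 : HasFDerivAt (fun y => F₂ (J y (γ t))) (fderiv ℝ (fun y => F₂ (J y (γ t))) x) x :=
    (h2c.differentiable one_ne_zero x).hasFDerivAt
  have hsq := ((hD1.pow 2).add (hD2.pow 2)).fderiv
  have hWa : ∀ a, F₁ (J x (γ t)) * fderiv ℝ (fun y => F₂ (J y (γ t))) x (unitVec a) -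
      F₂ (J x (γ t)) * fderiv ℝ (fun y => F₁ (J y (γ t))) x (unitVec a) =
      -fderiv ℝ (fun y => J y (γ t)) x (unitVec a) := fun a =>
    congrArg (fun A : Plane →L[ℝ] ℝ => A (unitVec a)) hW
  have hphi : ∀ a, phi k F₁ F₂ J (γ t) x a =
      1 / k * (F₁ (J x (γ t)) * fderiv ℝ (fun y => F₁ (J y (γ t))) x (unitVec a) +
        F₂ (J x (γ t)) * fderiv ℝ (fun y => F₂ (J y (γ t))) x (unitVec a)) := by
    intro a
    have e : (fun y => F₁ (J y (γ t)) ^ 2 + F₂ (J y (γ t)) ^ 2) =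
        (fun y => F₁ (J y (γ t)) ^ 2) + fun y => F₂ (J y (γ t)) ^ 2 := rfl
    simp only [phi, PiLp.smul_apply, gradient_apply, smul_eq_mul]
    rw [e, hsq]
    simp
    field_simp
  have hout1 : output F₁ F₂ J γ 0 t = fun y => F₁ (J y (γ t)) := rfl
  have hout2 : output F₁ F₂ J γ 1 t = fun y => F₂ (J y (γ t)) := rfl
  simp only [dirDeriv_axisField (differentiableAt_output h₁ h₂ _ t x), Fintype.sum_prod_type,
    Fin.sum_univ_two, hout1, hout2]
  have hW0 := hWa 0
  have hW1 := hWa 1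
  have hv : ∀ a b : Fin 2, unitVec a b = if b = a then 1 else 0 := fun a b => by
    simp [unitVec]
  ext b
  fin_cases b
  · simp [lieSystem, rotationalPart, gradient_apply, hphi, inputMean, twoToneMean, inputCoeff,
      hv, -one_div]
    simp only [neg_div, hplus, hminus]
    linear_combination (-ϑ) * hW0
  · simp [lieSystem, rotationalPart, gradient_apply, hphi, inputMean, twoToneMean, inputCoeff,
      hv, -one_div]
    simp only [neg_div, hplus, hminus]
    linear_combination (-ϑ) * hW1

/-- The averaging hypotheses hold for the inputs of the closed loop. -/
lemma exists_input_primitives {k : ℕ} (hk : 1 < k) (κ : ℝ) :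
    ∃ (V : Fin 2 × Fin 2 → ℝ → ℝ) (W : Fin 2 × Fin 2 → Fin 2 × Fin 2 → ℝ → ℝ) (B : ℝ), 0 ≤ B ∧
      (∀ i θ, |input k κ i θ| ≤ B) ∧ (∀ i θ, |V i θ| ≤ B) ∧ (∀ i j θ, |W i j θ| ≤ B) ∧
      (∀ i θ, HasDerivAt (V i) (input k κ i θ) θ) ∧
      ∀ i j θ, HasDerivAt (W i j) (V i θ * input k κ j θ - inputMean k κ i j) θ := by
  have hkinv := inv_lt_one_of_one_lt_nat hk
  have hkpos : 0 < 1 / (k : ℝ) := by positivity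
  have ha : 0 < 1 + 1 / (k : ℝ) := by positivity
  have hb : 0 < 1 - 1 / (k : ℝ) := by linarith
  have hab : 1 + 1 / (k : ℝ) ≠ 1 - 1 / k := by linarith
  choose W D hW hD using fun i j => hasBoundedPrimitive_twoTone_mul ha hb hab
    (inputCoeff κ 0 i) (inputCoeff κ 1 i) (inputCoeff κ 2 i) (inputCoeff κ 3 i)
    (inputCoeff κ 0 j) (inputCoeff κ 1 j) (inputCoeff κ 2 j) (inputCoeff κ 3 j)
  have hfin : ∀ b : Fin 2 × Fin 2 → ℝ, ∀ i, b i ≤ ∑ i, |b i| := fun b i =>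
    (le_abs_self _).trans (Finset.single_le_sum (f := fun i => |b i|)
      (fun _ _ => abs_nonneg _) (Finset.mem_univ i))
  set b₁ : Fin 2 × Fin 2 → ℝ := fun i => |inputCoeff κ 0 i| + |inputCoeff κ 1 i| +
    |inputCoeff κ 2 i| + |inputCoeff κ 3 i|
  set b₂ : Fin 2 × Fin 2 → ℝ := fun i => |-(inputCoeff κ 1 i / (1 + 1 / k))| +
    |inputCoeff κ 0 i / (1 + 1 / k)| + |-(inputCoeff κ 3 i / (1 - 1 / k))| +
    |inputCoeff κ 2 i / (1 - 1 / k)|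
  have hs₁ : 0 ≤ ∑ i, |b₁ i| := Finset.sum_nonneg fun _ _ => abs_nonneg _
  have hs₂ : 0 ≤ ∑ i, |b₂ i| := Finset.sum_nonneg fun _ _ => abs_nonneg _
  have hs₃ : 0 ≤ ∑ i, ∑ j, |D i j| :=
    Finset.sum_nonneg fun _ _ => Finset.sum_nonneg fun _ _ => abs_nonneg _
  refine ⟨_, W, ∑ i, |b₁ i| + ∑ i, |b₂ i| + ∑ i, ∑ j, |D i j|, by linarith, fun i θ => ?_,
    fun i θ => ?_, fun i j θ => ?_,
    fun i => hasDerivAt_twoTone_primitive ha.ne' hb.ne' _ _ _ _, hW⟩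
  · exact (abs_twoTone_le _ _ _ _ _ _ θ).trans ((hfin b₁ i).trans (by linarith))
  · exact (abs_twoTone_le _ _ _ _ _ _ θ).trans ((hfin b₂ i).trans (by linarith))
  · exact (hD i j θ).trans ((le_abs_self _).trans
      ((abs_le_sum_sum_abs D i j).trans (by linarith)))

/-- The trajectories of the closed loop converge to those of the Lie bracket system. -/
lemma approximates_closedLoop {k : ℕ} (hk : 1 < k) {ϑ : ℝ} (hϑ : 0 < ϑ)
    (hF : IsSeekingPair F₁ F₂) (hJ : ContDiff ℝ 2 (Function.uncurry J))
    (h₁ : ContDiff ℝ 1 (F₁ ∘ Function.uncurry J)) (h₂ : ContDiff ℝ 1 (F₂ ∘ Function.uncurry J))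
    (hA1 : AssumptionA1 (fields F₁ F₂ J γ)) (hA2 : AssumptionA2 (fields F₁ F₂ J γ)) :
    Approximates (closedLoop k ϑ F₁ F₂ J γ) (lieSystem k ϑ F₁ F₂ J γ) := by
  obtain ⟨V, W, B, hB, hv, hV, hW, hVd, hWd⟩ := exists_input_primitives hk (√(ϑ * alpha k) / 2)
  exact approximates_of_bounded_primitives hB hv hV hW hVd hWd
    (uniformlyTame_axisField hA1 hA2) (uniformlyTame_dirDeriv_axisField hA1 hA2 h₁ h₂)
    (fun ω hω t _ x => closedLoop_eq_sum k hω t x)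
    (fun t _ x => lieSystem_eq_sum hk hϑ hF hJ h₁ h₂ t x)

lemma locallySolvable_closedLoop {k : ℕ} (hk : 1 < k) (ϑ : ℝ)
    (hA1 : AssumptionA1 (fields F₁ F₂ J γ)) (hA2 : AssumptionA2 (fields F₁ F₂ J γ)) :
    LocallySolvable (closedLoop k ϑ F₁ F₂ J γ) := by
  obtain ⟨-, -, B, hB, hv, -⟩ := exists_input_primitives hk (√(ϑ * alpha k) / 2)
  exact locallySolvable_of_uniformlyTame hB hv (continuous_input k _)
    (uniformlyTame_axisField hA1 hA2) (fun ω hω t _ x => closedLoop_eq_sum k hω t x)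

end ClosedLoop

end UnicycleSeeking

end

theorem corollary1 (J : UnicycleSeeking.Plane → UnicycleSeeking.Plane → ℝ)
    (hJ : ContDiff ℝ 2 (Function.uncurry J))
    (γ : ℝ → UnicycleSeeking.Plane) (xmin : UnicycleSeeking.Plane → UnicycleSeeking.Plane)
    (hmin : ∀ t ≥ 0, ∀ x, x ≠ xmin (γ t) → J (xmin (γ t)) (γ t) < J x (γ t))
    (k : ℕ) (hk : 1 < k) (ϑ : ℝ) (hϑ : 0 < ϑ)
    (F₁ F₂ : ℝ → ℝ) (hF : UnicycleSeeking.IsSeekingPair F₁ F₂)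
    (hF₁J : ContDiff ℝ 1 (F₁ ∘ Function.uncurry J))
    (hF₂J : ContDiff ℝ 1 (F₂ ∘ Function.uncurry J))
    (hA1 : UnicycleSeeking.AssumptionA1 (UnicycleSeeking.fields F₁ F₂ J γ))
    (hA2 : UnicycleSeeking.AssumptionA2 (UnicycleSeeking.fields F₁ F₂ J γ))
    (lam : ℝ) (hlam : 0 < lam)
    (hS : ∃ S : Set UnicycleSeeking.Plane, IsCompact S ∧
      ∀ t ≥ 0, UnicycleSeeking.levelSet J xmin γ lam t ⊆ S) :
    (UnicycleSeeking.LocallyUAS (UnicycleSeeking.lieSystem k ϑ F₁ F₂ J γ)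
        (UnicycleSeeking.levelSet J xmin γ lam) →
      UnicycleSeeking.LocallyPracticallyUAS (UnicycleSeeking.closedLoop k ϑ F₁ F₂ J γ)
        (UnicycleSeeking.levelSet J xmin γ lam)) ∧
    (UnicycleSeeking.GloballyUAS (UnicycleSeeking.lieSystem k ϑ F₁ F₂ J γ)
        (UnicycleSeeking.levelSet J xmin γ lam) →
      UnicycleSeeking.SemigloballyPracticallyUAS (UnicycleSeeking.closedLoop k ϑ F₁ F₂ J γ)
        (UnicycleSeeking.levelSet J xmin γ lam)) := by
  obtain ⟨S, hSc, hS⟩ := hS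
  obtain ⟨R₀, hR₀⟩ := hSc.isBounded.exists_norm_le
  have hL : ∀ t ≥ 0, ∀ z ∈ UnicycleSeeking.levelSet J xmin γ lam t, ‖z‖ ≤ R₀ :=
    fun t ht z hz => hR₀ z (hS t ht hz)
  have happ := UnicycleSeeking.approximates_closedLoop hk hϑ hF hJ hF₁J hF₂J hA1 hA2
  have hsol := UnicycleSeeking.locallySolvable_closedLoop hk ϑ hA1 hA2
  exact ⟨UnicycleSeeking.locallyPracticallyUAS_of_approximates happ hsol hL,
    UnicycleSeeking.semigloballyPracticallyUAS_of_approximates happ hsol hL⟩
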